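/- Let $\alpha,\beta>-1$ with $\gamma:=\max\{\alpha,\beta\}>-1/2$, and let $\rho$ be the probability measure $d\rho(x)=c_{\alpha,\beta}(1-x)^\alpha(1+x)^\beta\,dx$ on $[-1,1]$, where $c_{\alpha,\beta}$ is the normalizing constant. For integers $1\le m<n$ let $x_1,\dots,x_n$ be i.i.d. with law $\rho$. Write $\|v\|=\left(\int|v|^2\,d\rho\right)^{1/2}$ and $\|v\|_{n,2}=\left(\frac1n\sum_{i=1}^n|v(x_i)|^2\right)^{1/2}$. Let $\mathbb P_m$ be the space of real polynomials of degree at most $m$, let $P_m^n(f)\in\mathbb P_m$ be the (almost surely unique) minimizer of $\|p-f\|_{n,2}$ over $p\in\mathbb P_m$, and let $$\kappa_2(P_m^n):=\sup_f\ \lim_{\delta\to0^+}\ \sup_{0<\|h\|_{n,2}\le\delta}\frac{\|P_m^n(f+h)-P_m^n(f)\|}{\|h\|_{n,2}}\in[0,\infty],$$ where $f$ and $h$ range over all real-valued functions. Then, up to constants and a factor of $\log n$, the sampling rate $n\asymp m^{2(1+\gamma)}$ is sufficient and necessary for $\kappa_2(P_m^n)\lesssim1$ with high probability, in the following sense. (Sufficiency.)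 For every $r>0$ there is a constant $c>0$, depending only on $\alpha,\beta,r$, such that for all integers $1\le m<n$ with $m^{2(1+\gamma)}\log n\le c\,n$, $$\mathbb P\left(\kappa_2(P_m^n)\le 2\right)\ \ge\ 1-2n^{-r}.$$ (Necessity.) For all $K>0$ and $\delta>0$ there is a constant $c>0$, depending only on $\alpha,\beta,K,\delta$, such that for all integers $1\le m<n$, $$\mathbb P\left(\kappa_2(P_m^n)\le K\right)\ge\delta\quad\Longrightarrow\quad n\ \ge\ c\,m^{2(1+\gamma)}.$$ -/

import Mathlib

open MeasureTheory
open scoped ENNReal Polynomial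

noncomputable section

namespace JacobiLS

/-- The normalising constant `c` of the Jacobi weight: the reciprocal of
`∫_{-1}^{1} (1 - t)^α (1 + t)^β dt`. -/
def jacobiConst (α β : ℝ) : ℝ :=
  (∫ t in Set.Icc (-1 : ℝ) 1, (1 - t) ^ α * (1 + t) ^ β)⁻¹

/-- The Jacobi weight `w(t) = c (1 - t)^α (1 + t)^β`. -/
def jacobiWeight (α β : ℝ) (t : ℝ) : ℝ :=
  jacobiConst α β * ((1 - t) ^ α * (1 + t) ^ β)

/-- The probability measure `dρ = w(t) dt` on `[-1, 1]` (as a measure on `ℝ` carried by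
`[-1, 1]`). -/
def jacobiMeasure (α β : ℝ) : Measure ℝ :=
  (volume.restrict (Set.Icc (-1 : ℝ) 1)).withDensity
    fun t => ENNReal.ofReal (jacobiWeight α β t)

/-- The joint law of `n` independent samples, each distributed according to the Jacobi weight. -/
def sampleLaw (α β : ℝ) (n : ℕ) : Measure (Fin n → ℝ) :=
  Measure.pi fun _ => jacobiMeasure α β

/-- The `L²(ρ)` norm `(∫ |p|² dρ)^{1/2}` of a polynomial. -/
def l2Norm (ρ : Measure ℝ) (p : ℝ[X]) : ℝ :=
  Real.sqrt (∫ t, |p.eval t| ^ 2 ∂ρ)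

/-- The empirical semi-norm `((1/n) ∑ |v(x_i)|²)^{1/2}` at the sampling points `x`. -/
def empNorm {n : ℕ} (x : Fin n → ℝ) (v : ℝ → ℝ) : ℝ :=
  Real.sqrt ((1 / (n : ℝ)) * ∑ i, |v (x i)| ^ 2)

/-- `p` is a minimiser of the empirical distance to `f` among the polynomials of degree at
most `m`. -/
def IsLeastSquares (m : ℕ) {n : ℕ} (x : Fin n → ℝ) (f : ℝ → ℝ) (p : ℝ[X]) : Prop :=
  p ∈ Polynomial.degreeLE ℝ m ∧
    ∀ q ∈ Polynomial.degreeLE ℝ m,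
      empNorm x (fun t => p.eval t - f t) ≤ empNorm x (fun t => q.eval t - f t)

/-- The discrete least squares projection `P_m^n(f)`. A minimiser always exists; it is unique
as soon as `m + 1` of the sampling points are distinct, which has probability one for `m < n`. -/
def leastSquares (m : ℕ) {n : ℕ} (x : Fin n → ℝ) (f : ℝ → ℝ) : ℝ[X] :=
  Classical.epsilon (IsLeastSquares m x f)

/-- The condition number
`κ₂(P_m^n) = sup_f lim_{δ → 0+} sup_{0 < ‖h‖_{n,2} ≤ δ} ‖P_m^n(f + h) - P_m^n(f)‖ / ‖h‖_{n,2}`,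
with values in `[0, ∞]`. The inner supremum is nondecreasing in `δ`, so its limit as `δ → 0+`
is its infimum over `δ > 0`. -/
def condNumber (ρ : Measure ℝ) (m : ℕ) {n : ℕ} (x : Fin n → ℝ) : ℝ≥0∞ :=
  ⨆ f : ℝ → ℝ, ⨅ δ : ℝ, ⨅ _ : 0 < δ,
    ⨆ h : ℝ → ℝ, ⨆ _ : 0 < empNorm x h ∧ empNorm x h ≤ δ,
      ENNReal.ofReal
        (l2Norm ρ (leastSquares m x (fun t => f t + h t) - leastSquares m x f) / empNorm x h)

end JacobiLS

end

/-!
Let `X = φ φᵀ`, where `φ` is an orthonormal basis of the polynomials of degree at most `m` in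
`L²(ρ)`. The least squares projection satisfies `‖P(f + h) - P(f)‖_{n,2} ≤ ‖h‖_{n,2}` and
reproduces polynomials, so that the condition number is the best constant `κ` in
`‖p‖ ≤ κ ‖p‖_{n,2}` on that space (`condNumber_le` and, for distinct points,
`l2Norm_le_of_condNumber_le`).

*Sufficiency.* `κ ≤ 2` means that the smallest eigenvalue of the empirical Gram matrix
`(1 / n) ∑ X(x_i)`, whose mean is the identity, is at least `1 / 4`. The lower tail matrix
Chernoff bound `measure_exists_sum_sq_lt_le` makes the failure probability at most
`(m + 1) exp (-3 n / (8 K))`, where `K` bounds the Christoffel function `∑ φ_k(x) ^ 2` on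
`[-1, 1]`. It is derived from the Golden–Thompson inequality `trace_exp_add_le` by averaging over
one sample at a time. The Nikolskii inequality `exists_eval_sq_le_integral_sq` gives `K` of the
order of `m ^ (2 (1 + γ))`: by Bernstein's inequality (`abs_eval_cos_sub_le`) `|p|` exceeds half
its maximum on an arc of length `≍ 1 / m` in the variable `arccos`, and such an arc has
`ρ`-measure at least of the order of `m ^ (-2 (1 + γ))`, the worst case being an arc at the end
point with the larger exponent.

*Necessity.* That worst case is attained: powers of the Fejér-type polynomials
`(1 - T k) / (1 - X)` with `k ≍ m`, or their reflections, carry all but a fraction `ε` of their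
`L²(ρ)` mass in a cap of measure `≲ m ^ (-2 (1 + γ))` (`concentratesAtRate_max`). If `n` is much
smaller than `m ^ (2 (1 + γ))`, then with probability close to one no sample falls into the cap,
and by Markov's inequality the empirical norm of the polynomial is then a small multiple of its
norm (`measure_condNumber_le_le`), so that `κ` is large.
-/

noncomputable section

namespace JacobiLS

/-! ### The Golden–Thompson inequality -/

section

open Matrix

theorem trace_mul_le_half_add {d : Type*} [Fintype d] (R S : Matrix d d ℝ)
    (hR : R.IsSymm) (hS : S.IsSymm) :
    (R * S).trace ≤ ((R * R).trace + (S * S).trace) / 2 := by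
  have h : 0 ≤ ((R - S)ᵀ * (R - S)).trace := by
    rw [Matrix.trace]
    refine Finset.sum_nonneg fun i _ => ?_
    simp only [Matrix.diag_apply, Matrix.mul_apply, Matrix.transpose_apply]
    exact Finset.sum_nonneg fun j _ => mul_self_nonneg _
  rw [Matrix.transpose_sub, hR.eq, hS.eq, Matrix.sub_mul, Matrix.mul_sub, Matrix.mul_sub,
    Matrix.trace_sub, Matrix.trace_sub, Matrix.trace_sub, Matrix.trace_mul_comm S R] at h
  linarith

theorem trace_sq_le_trace_mul_transpose {d : Type*} [Fintype d] (X : Matrix d d ℝ) :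
    (X * X).trace ≤ (X * Xᵀ).trace := by
  have h : 0 ≤ ((X - Xᵀ) * (X - Xᵀ)ᵀ).trace := by
    rw [Matrix.trace]
    refine Finset.sum_nonneg fun i _ => ?_
    simp only [Matrix.diag_apply, Matrix.mul_apply, Matrix.transpose_apply]
    exact Finset.sum_nonneg fun j _ => mul_self_nonneg _
  have h2 : (Xᵀ * Xᵀ).trace = (X * X).trace := by
    rw [← Matrix.transpose_mul, Matrix.trace_transpose]
  rw [Matrix.transpose_sub, Matrix.transpose_transpose, Matrix.sub_mul, Matrix.mul_sub,
    Matrix.mul_sub, Matrix.trace_sub, Matrix.trace_sub, Matrix.trace_sub, h2,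
    Matrix.trace_mul_comm Xᵀ X] at h
  linarith

theorem trace_mul_pow_comm {d : Type*} [Fintype d] [DecidableEq d]
    (A B : Matrix d d ℝ) (k : ℕ) :
    ((A * B) ^ k).trace = ((B * A) ^ k).trace := by
  cases k with
  | zero => simp
  | succ k =>
    rw [pow_succ, ← mul_assoc, Matrix.trace_mul_comm, ← mul_assoc, pow_succ']
    congr 1
    have : ∀ j : ℕ, B * (A * B) ^ j = (B * A) ^ j * B := by
      intro j
      induction j with
      | zero => simp
      | succ j ih => rw [pow_succ, ← mul_assoc, ih, pow_succ]; simp only [mul_assoc]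
    rw [this, mul_assoc, ← pow_succ, pow_succ']

/-- Two families of trace inequalities, proved by a joint induction: the first comparing a power of
`X` with a power of `X Xᵀ`, the second separating the factors of `P Q`. Each step of either family
uses both families at the previous exponent. -/
theorem trace_pow_two_pow_le {d : Type*} [Fintype d] [DecidableEq d] (j : ℕ) :
    (∀ X : Matrix d d ℝ, (X ^ 2 ^ (j + 1)).trace ≤ ((X * Xᵀ) ^ 2 ^ j).trace) ∧
    (∀ P Q : Matrix d d ℝ, P.IsSymm → Q.IsSymm →
      ((P * Q) ^ 2 ^ j).trace ≤ (P ^ 2 ^ j * Q ^ 2 ^ j).trace) := by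
  induction j with
  | zero =>
    refine ⟨fun X => ?_, fun P Q _ _ => by simp⟩
    simpa [pow_two] using trace_sq_le_trace_mul_transpose X
  | succ j ih =>
    obtain ⟨hS, hT⟩ := ih
    refine ⟨fun X => ?_, fun P Q hP hQ => ?_⟩
    · have hP : (Xᵀ * X).IsSymm := by simp [Matrix.IsSymm]
      have hQ : (X * Xᵀ).IsSymm := by simp [Matrix.IsSymm]
      calc (X ^ 2 ^ (j + 1 + 1)).trace = ((X * X) ^ 2 ^ (j + 1)).trace := by
            rw [← pow_two, ← pow_mul]; congr 2; ring
        _ ≤ ((X * X * (X * X)ᵀ) ^ 2 ^ j).trace := hS _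
        _ = ((Xᵀ * X * (X * Xᵀ)) ^ 2 ^ j).trace := by
            rw [Matrix.transpose_mul, ← mul_assoc, trace_mul_pow_comm]
            simp only [mul_assoc]
        _ ≤ ((Xᵀ * X) ^ 2 ^ j * (X * Xᵀ) ^ 2 ^ j).trace := hT _ _ hP hQ
        _ ≤ _ := trace_mul_le_half_add _ _ (hP.pow _) (hQ.pow _)
        _ = ((X * Xᵀ) ^ 2 ^ (j + 1)).trace := by
            rw [← pow_add, ← pow_add, trace_mul_pow_comm Xᵀ X,
              show 2 ^ j + 2 ^ j = 2 ^ (j + 1) by ring]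
            ring
    · calc ((P * Q) ^ 2 ^ (j + 1)).trace ≤ ((P * Q * (P * Q)ᵀ) ^ 2 ^ j).trace := hS _
        _ = ((P * P * (Q * Q)) ^ 2 ^ j).trace := by
            rw [Matrix.transpose_mul, hP.eq, hQ.eq, ← mul_assoc, trace_mul_pow_comm]
            simp only [mul_assoc]
        _ ≤ ((P * P) ^ 2 ^ j * (Q * Q) ^ 2 ^ j).trace :=
            hT _ _ (by simp [Matrix.IsSymm, hP.eq]) (by simp [Matrix.IsSymm, hQ.eq])
        _ = _ := by
            rw [← pow_two, ← pow_two, ← pow_mul, ← pow_mul, pow_succ' 2 j]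

theorem norm_exp_le_exp_norm {𝔸 : Type*} [NormedRing 𝔸] [NormedAlgebra ℝ 𝔸] [CompleteSpace 𝔸]
    [NormOneClass 𝔸] (A : 𝔸) : ‖NormedSpace.exp A‖ ≤ Real.exp ‖A‖ := by
  rw [congrFun (NormedSpace.exp_eq_tsum ℝ) A]
  refine tsum_of_norm_bounded (g := fun n : ℕ => ‖A‖ ^ n / n.factorial) ?_ fun n => ?_
  · rw [Real.exp_eq_exp_ℝ]
    exact NormedSpace.expSeries_div_hasSum_exp ‖A‖
  · rw [norm_smul, norm_inv, Real.norm_natCast, div_eq_inv_mul]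
    gcongr
    exact norm_pow_le _ _

/-- The Lie product formula in a Banach algebra. -/
theorem tendsto_exp_mul_exp_pow {𝔸 : Type*} [NormedRing 𝔸] [NormedAlgebra ℝ 𝔸] [CompleteSpace 𝔸]
    [NormOneClass 𝔸] (A B : 𝔸) :
    Filter.Tendsto (fun N : ℕ => (NormedSpace.exp ((N : ℝ)⁻¹ • A) *
      NormedSpace.exp ((N : ℝ)⁻¹ • B)) ^ N) Filter.atTop (nhds (NormedSpace.exp (A + B))) := by
  -- a telescoping estimate for the difference of two `N`-th powers
  have key : ∀ (C D : 𝔸) (R : ℝ), ‖C‖ ≤ R → ‖D‖ ≤ R → 1 ≤ R → ∀ N : ℕ,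
      ‖C ^ N - D ^ N‖ ≤ N * (R ^ N * ‖C - D‖) := by
    intro C D R hC hD hR N
    induction N with
    | zero => simp
    | succ N ih =>
      have : C ^ (N + 1) - D ^ (N + 1) = C * (C ^ N - D ^ N) + (C - D) * D ^ N := by
        rw [pow_succ', pow_succ']; noncomm_ring
      rw [this]
      have h1 : ‖C * (C ^ N - D ^ N)‖ ≤ R * (N * (R ^ N * ‖C - D‖)) :=
        (norm_mul_le _ _).trans (mul_le_mul hC ih (norm_nonneg _) (by linarith))
      have h2 : ‖(C - D) * D ^ N‖ ≤ ‖C - D‖ * R ^ (N + 1) := by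
        refine (norm_mul_le _ _).trans (mul_le_mul_of_nonneg_left ?_ (norm_nonneg _))
        refine (norm_pow_le _ _).trans ((pow_le_pow_left₀ (norm_nonneg _) hD _).trans ?_)
        exact pow_le_pow_right₀ hR (Nat.le_succ _)
      refine (norm_add_le _ _).trans ((add_le_add h1 h2).trans (le_of_eq ?_))
      push_cast; ring
  -- the `N`-th roots of the two sides differ by `o(1 / N)`
  have hderiv : HasDerivAt (fun t : ℝ => NormedSpace.exp (t • A) * NormedSpace.exp (t • B) -
      NormedSpace.exp (t • (A + B))) 0 0 := by
    have hA := hasDerivAt_exp_smul_const (𝕂 := ℝ) A (0 : ℝ)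
    have hB := hasDerivAt_exp_smul_const (𝕂 := ℝ) B (0 : ℝ)
    have hAB := hasDerivAt_exp_smul_const (𝕂 := ℝ) (A + B) (0 : ℝ)
    have h := (hA.mul hB).sub hAB
    simp only [zero_smul, NormedSpace.exp_zero, one_mul, mul_one, sub_self] at h
    exact h
  have hlim := hderiv.tendsto_slope_zero
  simp only [zero_add, zero_smul, NormedSpace.exp_zero, one_mul, sub_self, sub_zero] at hlim
  have hN : Filter.Tendsto (fun N : ℕ => (N : ℝ)⁻¹) Filter.atTop (nhdsWithin 0 {0}ᶜ) := by
    refine tendsto_nhdsWithin_iff.2 ⟨tendsto_inv_atTop_nhds_zero_nat, ?_⟩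
    filter_upwards [Filter.eventually_gt_atTop 0] with N hN
    simp [hN.ne']
  have hlim2 := (hlim.comp hN).norm.const_mul (Real.exp (‖A‖ + ‖B‖))
  rw [norm_zero, mul_zero] at hlim2
  rw [tendsto_iff_norm_sub_tendsto_zero]
  refine squeeze_zero' (Filter.Eventually.of_forall fun _ => norm_nonneg _) ?_ hlim2
  filter_upwards [Filter.eventually_gt_atTop 0] with N hN
  have hN0 : (0 : ℝ) < N := by exact_mod_cast hN
  have hpow : NormedSpace.exp (A + B) = NormedSpace.exp ((N : ℝ)⁻¹ • (A + B)) ^ N := by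
    let _ : NormedAlgebra ℚ 𝔸 := NormedAlgebra.restrictScalars ℚ ℝ 𝔸
    rw [← NormedSpace.exp_nsmul, ← Nat.cast_smul_eq_nsmul ℝ, smul_smul,
      mul_inv_cancel₀ hN0.ne', one_smul]
  have hbound : ∀ C : 𝔸, ‖(N : ℝ)⁻¹ • C‖ = (N : ℝ)⁻¹ * ‖C‖ := fun C => by
    rw [norm_smul, norm_inv, Real.norm_natCast]
  have hmain := key (NormedSpace.exp ((N : ℝ)⁻¹ • A) * NormedSpace.exp ((N : ℝ)⁻¹ • B))
    (NormedSpace.exp ((N : ℝ)⁻¹ • (A + B))) (Real.exp ((N : ℝ)⁻¹ * (‖A‖ + ‖B‖))) ?_ ?_ ?_ N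
  · rw [hpow]
    refine hmain.trans (le_of_eq ?_)
    rw [← Real.exp_nat_mul, ← mul_assoc (N : ℝ) (N : ℝ)⁻¹, mul_inv_cancel₀ hN0.ne', one_mul]
    simp only [Function.comp, norm_smul, inv_inv, Real.norm_natCast]
    ring
  · refine (norm_mul_le _ _).trans ?_
    rw [mul_add, Real.exp_add, ← hbound, ← hbound]
    exact mul_le_mul (norm_exp_le_exp_norm _) (norm_exp_le_exp_norm _) (norm_nonneg _)
      (Real.exp_pos _).le
  · refine (norm_exp_le_exp_norm _).trans (Real.exp_le_exp.2 ?_)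
    rw [hbound]
    gcongr
    exact norm_add_le _ _
  · exact Real.one_le_exp (by positivity)

/-- The Golden–Thompson inequality for real symmetric matrices. -/
theorem trace_exp_add_le {d : Type*} [Fintype d] [DecidableEq d] {A B : Matrix d d ℝ}
    (hA : A.IsSymm) (hB : B.IsSymm) :
    (NormedSpace.exp (A + B)).trace ≤ (NormedSpace.exp A * NormedSpace.exp B).trace := by
  rcases isEmpty_or_nonempty d with hd | hd
  · simp [Matrix.trace]
  let _ : NormedRing (Matrix d d ℝ) := Matrix.linftyOpNormedRing
  let _ : NormedAlgebra ℝ (Matrix d d ℝ) := Matrix.linftyOpNormedAlgebra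
  have : NormOneClass (Matrix d d ℝ) := Matrix.linfty_opNormOneClass
  have h1 := (tendsto_exp_mul_exp_pow A B).comp
    (tendsto_pow_atTop_atTop_of_one_lt (one_lt_two : (1 : ℕ) < 2))
  have h2 := ((continuous_id (X := Matrix d d ℝ)).matrix_trace.tendsto _).comp h1
  refine le_of_tendsto h2 (Filter.Eventually.of_forall fun i => ?_)
  have hpow : ∀ C : Matrix d d ℝ,
      NormedSpace.exp (((2 ^ i : ℕ) : ℝ)⁻¹ • C) ^ 2 ^ i = NormedSpace.exp C := by
    intro C
    rw [← Matrix.exp_nsmul, ← Nat.cast_smul_eq_nsmul ℝ, smul_smul,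
      mul_inv_cancel₀ (by positivity), one_smul]
  have h3 := (trace_pow_two_pow_le i).2 (NormedSpace.exp (((2 ^ i : ℕ) : ℝ)⁻¹ • A))
    (NormedSpace.exp (((2 ^ i : ℕ) : ℝ)⁻¹ • B)) (hA.smul _).exp (hB.smul _).exp
  rw [hpow, hpow] at h3
  exact h3

end

/-! ### A matrix Chernoff bound for the lower tail -/

section

open Matrix

theorem exp_smul_of_isIdempotentElem {d : Type*} [Fintype d] [DecidableEq d] {P : Matrix d d ℝ}
    (hP : P * P = P) (c : ℝ) : NormedSpace.exp (c • P) = 1 + (Real.exp c - 1) • P := by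
  let _ : NormedRing (Matrix d d ℝ) := Matrix.linftyOpNormedRing
  let _ : NormedAlgebra ℝ (Matrix d d ℝ) := Matrix.linftyOpNormedAlgebra
  have hpow : ∀ n : ℕ, P ^ (n + 1) = P := by
    intro n
    induction n with
    | zero => simp
    | succ n ih => rw [pow_succ, ih, hP]
  have h1 := NormedSpace.exp_series_hasSum_exp' (𝕂 := ℝ) (c • P)
  have h2 : HasSum (fun n : ℕ => (c ^ n / n.factorial) • P + (if n = 0 then 1 - P else 0))
      (Real.exp c • P + (1 - P)) := by
    refine HasSum.add (HasSum.smul_const ?_ P) (hasSum_ite_eq 0 (1 - P))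
    rw [Real.exp_eq_exp_ℝ]
    exact NormedSpace.expSeries_div_hasSum_exp c
  have h3 : (fun n : ℕ => ((n.factorial : ℝ)⁻¹) • (c • P) ^ n) =
      fun n : ℕ => (c ^ n / n.factorial) • P + (if n = 0 then 1 - P else 0) := by
    funext n
    cases n with
    | zero => simp
    | succ n => rw [smul_pow, hpow, smul_smul, div_eq_inv_mul]; simp
  rw [h3] at h1
  refine (h1.unique h2).trans ?_
  rw [sub_smul, one_smul]
  abel

theorem isSymm_vecMulVec_self {d : Type*} (v : d → ℝ) : (vecMulVec v v).IsSymm := by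
  ext i j
  simp [vecMulVec_apply, mul_comm]

/-- The elementary convexity estimate behind the Chernoff bound: the chord slope of
`s ↦ 1 - exp (-s / K)` from the origin is smallest at the right end of `[0, K]`. -/
theorem one_sub_exp_neg_div_ge {K s : ℝ} (hs : 0 ≤ s) (hK : 0 < K) (hsK : s ≤ K) :
    (1 - Real.exp (-1)) / K * s ≤ 1 - Real.exp (-(s / K)) := by
  have h := convexOn_exp.2 (Set.mem_univ (0 : ℝ)) (Set.mem_univ (-1 : ℝ))
    (sub_nonneg.2 ((div_le_one hK).2 hsK)) (div_nonneg hs hK.le) (by ring)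
  simp only [smul_eq_mul, mul_zero, zero_add, Real.exp_zero, mul_one, mul_neg] at h
  have h2 : (1 - Real.exp (-1)) / K * s = s / K - s / K * Real.exp (-1) := by ring
  rw [h2]
  linarith

/-- For a rank one matrix the exponential is explicit, and the bound of `one_sub_exp_neg_div_ge`
applies to it. -/
theorem trace_mul_exp_neg_smul_vecMulVec_le {d : Type*} [Fintype d] [DecidableEq d]
    {E : Matrix d d ℝ} {v : d → ℝ} (hE : 0 ≤ v ⬝ᵥ E *ᵥ v) {K : ℝ} (hK : 0 < K)
    (hv : v ⬝ᵥ v ≤ K) :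
    (E * NormedSpace.exp (-(K⁻¹ • vecMulVec v v))).trace ≤
      E.trace - (1 - Real.exp (-1)) / K * (v ⬝ᵥ E *ᵥ v) := by
  have htr : (E * vecMulVec v v).trace = v ⬝ᵥ E *ᵥ v := by
    rw [mul_vecMulVec, trace_vecMulVec, dotProduct_comm]
  have hs0 : 0 ≤ v ⬝ᵥ v := by
    simp only [dotProduct]
    exact Finset.sum_nonneg fun i _ => mul_self_nonneg _
  rcases hs0.eq_or_lt with hs | hs
  · have : v = 0 := by
      rwa [eq_comm, dotProduct_self_eq_zero] at hs
    subst this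
    simp
  set s := v ⬝ᵥ v with hsdef
  have hidem : (s⁻¹ • vecMulVec v v) * (s⁻¹ • vecMulVec v v) = s⁻¹ • vecMulVec v v := by
    rw [smul_mul_smul_comm, vecMulVec_mul_vecMulVec, ← hsdef, vecMulVec_smul, smul_smul]
    congr 1
    field_simp
  have hrw : -(K⁻¹ • vecMulVec v v) = (-(s / K)) • (s⁻¹ • vecMulVec v v) := by
    rw [smul_smul, ← neg_smul]
    congr 1
    field_simp
  rw [hrw, exp_smul_of_isIdempotentElem hidem, mul_add, mul_one, trace_add, mul_smul_comm,
    mul_smul_comm, trace_smul, trace_smul, htr, smul_eq_mul, smul_eq_mul]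
  have h := one_sub_exp_neg_div_ge hs.le hK hv
  have h2 : (1 - Real.exp (-1)) / K ≤ (1 - Real.exp (-(s / K))) / s := by
    rwa [le_div_iff₀ hs]
  have h3 := mul_le_mul_of_nonneg_right h2 hE
  have h4 : (Real.exp (-(s / K)) - 1) * (s⁻¹ * (v ⬝ᵥ E *ᵥ v)) =
    -((1 - Real.exp (-(s / K))) / s * (v ⬝ᵥ E *ᵥ v)) := by
    field_simp
    ring
  rw [h4]
  linarith

theorem exp_quadForm_nonneg {d : Type*} [Fintype d] [DecidableEq d] {S : Matrix d d ℝ}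
    (hS : S.IsSymm) (v : d → ℝ) : 0 ≤ v ⬝ᵥ NormedSpace.exp S *ᵥ v := by
  have h1 : NormedSpace.exp S =
      (NormedSpace.exp ((2 : ℝ)⁻¹ • S))ᵀ * NormedSpace.exp ((2 : ℝ)⁻¹ • S) := by
    rw [(hS.smul _).exp.eq, ← pow_two, ← Matrix.exp_nsmul, ← Nat.cast_smul_eq_nsmul ℝ, smul_smul]
    norm_num
  rw [h1, ← mulVec_mulVec, dotProduct_mulVec, vecMul_transpose]
  simp only [dotProduct]
  exact Finset.sum_nonneg fun i _ => mul_self_nonneg _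

/-- The trace of the exponential dominates the exponential of every value of the quadratic form on
the unit sphere. -/
theorem exp_quadForm_le_trace_exp {d : Type*} [Fintype d] [DecidableEq d] {M : Matrix d d ℝ}
    (hM : M.IsSymm) {v : d → ℝ} (hv : v ⬝ᵥ v = 1) :
    Real.exp (v ⬝ᵥ M *ᵥ v) ≤ (NormedSpace.exp M).trace := by
  have hH : M.IsHermitian := by
    rw [Matrix.IsHermitian, conjTranspose_eq_transpose_of_trivial]; exact hM
  set U : Matrix d d ℝ := (hH.eigenvectorUnitary : Matrix d d ℝ) with hU
  have hUU : Uᵀ * U = 1 := by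
    have := Unitary.star_mul_self_of_mem hH.eigenvectorUnitary.2
    rwa [star_eq_conjTranspose, conjTranspose_eq_transpose_of_trivial] at this
  have hUU' : U * Uᵀ = 1 := mul_eq_one_comm.1 hUU
  have hspec : M = U * diagonal hH.eigenvalues * Uᵀ := by
    have h := hH.spectral_theorem
    rw [Unitary.conjStarAlgAut_apply] at h
    exact h
  have hinv : U⁻¹ = Uᵀ := inv_eq_left_inv hUU
  have hunit : IsUnit U := IsUnit.of_mul_eq_one _ hUU'
  have hexp : (NormedSpace.exp M).trace = ∑ i, Real.exp (hH.eigenvalues i) := by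
    conv_lhs => rw [hspec, ← hinv]
    rw [Matrix.exp_conj _ _ hunit, hinv, trace_mul_comm, ← mul_assoc, hUU, one_mul, exp_diagonal,
      trace_diagonal]
    refine Finset.sum_congr rfl fun i _ => ?_
    rw [Pi.coe_exp, Real.exp_eq_exp_ℝ]
  set w := Uᵀ *ᵥ v with hw
  have hww : ∑ i, w i ^ 2 = 1 := by
    have : w ⬝ᵥ w = 1 := by
      rw [hw, dotProduct_mulVec, vecMul_transpose, mulVec_mulVec, hUU', one_mulVec, hv]
    rw [← this, dotProduct]
    exact Finset.sum_congr rfl fun i _ => pow_two _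
  have hquad : v ⬝ᵥ M *ᵥ v = ∑ i, hH.eigenvalues i * w i ^ 2 := by
    conv_lhs => rw [hspec]
    rw [← mulVec_mulVec, ← mulVec_mulVec, dotProduct_mulVec, ← mulVec_transpose, ← hw,
      dotProduct]
    refine Finset.sum_congr rfl fun i _ => ?_
    rw [mulVec_diagonal]
    ring
  -- the value of the quadratic form is an average of the eigenvalues
  have hne : ∃ i, v ⬝ᵥ M *ᵥ v ≤ hH.eigenvalues i := by
    by_contra! hcon
    have h1 : ∑ i, (v ⬝ᵥ M *ᵥ v - hH.eigenvalues i) * w i ^ 2 = 0 := by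
      simp only [sub_mul, Finset.sum_sub_distrib, ← Finset.mul_sum, hww, ← hquad]
      ring
    rw [Finset.sum_eq_zero_iff_of_nonneg
      (fun i _ => mul_nonneg (sub_nonneg.2 (hcon i).le) (sq_nonneg _))] at h1
    have h2 : ∀ i, w i ^ 2 = 0 := fun i =>
      (mul_eq_zero.1 (h1 i (Finset.mem_univ i))).resolve_left (sub_pos.2 (hcon i)).ne'
    simp [h2] at hww
  obtain ⟨i, hi⟩ := hne
  rw [hexp]
  exact (Real.exp_le_exp.2 hi).trans (Finset.single_le_sum
    (f := fun i => Real.exp (hH.eigenvalues i)) (fun _ _ => (Real.exp_pos _).le)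
    (Finset.mem_univ i))


/-- One step of the iterated Golden–Thompson argument: averaging over a single sample multiplies the
trace of the exponential by at most `exp (-(1 - e⁻¹) / K)`. -/
theorem lintegral_trace_exp_sub_le {Ω : Type*} [MeasurableSpace Ω] {μ : Measure Ω}
    [IsProbabilityMeasure μ] {d : Type*} [Fintype d] [DecidableEq d] {φ : Ω → d → ℝ} {K : ℝ}
    (hK : 0 < K) (hφ : ∀ᵐ y ∂μ, φ y ⬝ᵥ φ y ≤ K)
    (hint : ∀ i j, Integrable (fun y => φ y i * φ y j) μ)
    (horth : ∀ i j, ∫ y, φ y i * φ y j ∂μ = if i = j then 1 else 0)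
    {S : Matrix d d ℝ} (hS : S.IsSymm) :
    ∫⁻ y, ENNReal.ofReal (NormedSpace.exp (S - K⁻¹ • vecMulVec (φ y) (φ y))).trace ∂μ ≤
      ENNReal.ofReal (Real.exp (-((1 - Real.exp (-1)) / K)) * (NormedSpace.exp S).trace) := by
  set E := NormedSpace.exp S with hE
  set κ := (1 - Real.exp (-1)) / K with hκ
  have hquad : ∀ y, φ y ⬝ᵥ E *ᵥ φ y = ∑ i, ∑ j, E i j * (φ y i * φ y j) := by
    intro y
    simp only [dotProduct, mulVec, Finset.mul_sum]
    exact Finset.sum_congr rfl fun i _ => Finset.sum_congr rfl fun j _ => by ring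
  have hqint : Integrable (fun y => φ y ⬝ᵥ E *ᵥ φ y) μ := by
    simp only [hquad]
    exact integrable_finsetSum _ fun i _ => integrable_finsetSum _ fun j _ =>
      (hint i j).const_mul _
  have hqval : ∫ y, φ y ⬝ᵥ E *ᵥ φ y ∂μ = E.trace := by
    simp only [hquad]
    refine (integral_finsetSum _ fun i _ => integrable_finsetSum _ fun j _ =>
      (hint i j).const_mul _).trans ?_
    refine Finset.sum_congr rfl fun i _ => ?_
    refine (integral_finsetSum _ fun j _ => (hint i j).const_mul _).trans ?_
    simp [integral_const_mul, horth]
  have hstep : ∀ᵐ y ∂μ, (NormedSpace.exp (S - K⁻¹ • vecMulVec (φ y) (φ y))).trace ≤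
      E.trace - κ * (φ y ⬝ᵥ E *ᵥ φ y) := by
    filter_upwards [hφ] with y hy
    rw [sub_eq_add_neg]
    exact (trace_exp_add_le hS ((isSymm_vecMulVec_self (φ y)).smul K⁻¹).neg).trans
      (trace_mul_exp_neg_smul_vecMulVec_le (exp_quadForm_nonneg hS _) hK hy)
  have hpos : ∀ M : Matrix d d ℝ, M.IsSymm → 0 ≤ (NormedSpace.exp M).trace := by
    intro M hM
    simp only [Matrix.trace, diag_apply]
    refine Finset.sum_nonneg fun i _ => ?_
    have := exp_quadForm_nonneg hM (Pi.single i 1)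
    simpa using this
  calc _ ≤ ∫⁻ y, ENNReal.ofReal (E.trace - κ * (φ y ⬝ᵥ E *ᵥ φ y)) ∂μ :=
        lintegral_mono_ae (hstep.mono fun y hy => ENNReal.ofReal_le_ofReal hy)
    _ = ENNReal.ofReal (∫ y, E.trace - κ * (φ y ⬝ᵥ E *ᵥ φ y) ∂μ) := by
        refine (ofReal_integral_eq_lintegral_ofReal
          ((integrable_const _).sub (hqint.const_mul _)) ?_).symm
        filter_upwards [hstep] with y hy
        exact (hpos _ (hS.sub ((isSymm_vecMulVec_self (φ y)).smul K⁻¹))).trans hy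
    _ ≤ _ := by
        rw [integral_sub (integrable_const _) (hqint.const_mul _), integral_const_mul, hqval]
        simp only [integral_const, probReal_univ, one_smul]
        refine ENNReal.ofReal_le_ofReal ?_
        have h1 := Real.add_one_le_exp (-κ)
        have h2 := mul_le_mul_of_nonneg_right h1 (hpos S hS)
        rw [← hE] at h2
        linarith

theorem measurable_trace_exp {Ω : Type*} [MeasurableSpace Ω] {d : Type*} [Fintype d]
    [DecidableEq d] {F : Ω → Matrix d d ℝ} (hF : ∀ i j, Measurable fun y => F y i j) :
    Measurable fun y => (NormedSpace.exp (F y)).trace := by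
  let _ : NormedRing (Matrix d d ℝ) := Matrix.linftyOpNormedRing
  let _ : NormedAlgebra ℝ (Matrix d d ℝ) := Matrix.linftyOpNormedAlgebra
  have hcont : Continuous fun M : d → d → ℝ => (NormedSpace.exp (Matrix.of M)).trace := by
    have h1 : Continuous fun M : Matrix d d ℝ => NormedSpace.exp M :=
      letI : NormedAlgebra ℚ (Matrix d d ℝ) := NormedAlgebra.restrictScalars ℚ ℝ _
      NormedSpace.exp_continuous
    exact (h1.comp (continuous_id (X := d → d → ℝ))).matrix_trace
  exact hcont.measurable.comp (measurable_pi_lambda _ fun i =>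
    measurable_pi_lambda _ fun j => hF i j)

/-- Iterating `lintegral_trace_exp_sub_le` over independent samples. In each step the
remaining samples are held fixed, as part of the symmetric matrix of that lemma. -/
theorem lintegral_pi_trace_exp_sub_sum_le {Ω : Type*} [MeasurableSpace Ω] {μ : Measure Ω}
    [IsProbabilityMeasure μ] {d : Type*} [Fintype d] [DecidableEq d] {φ : Ω → d → ℝ} {K : ℝ}
    (hK : 0 < K) (hmeas : ∀ i, Measurable fun y => φ y i)
    (hφ : ∀ᵐ y ∂μ, φ y ⬝ᵥ φ y ≤ K)
    (hint : ∀ i j, Integrable (fun y => φ y i * φ y j) μ)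
    (horth : ∀ i j, ∫ y, φ y i * φ y j ∂μ = if i = j then 1 else 0)
    (n : ℕ) {A : Matrix d d ℝ} (hA : A.IsSymm) :
    ∫⁻ x : Fin n → Ω, ENNReal.ofReal
        (NormedSpace.exp (A - K⁻¹ • ∑ i, vecMulVec (φ (x i)) (φ (x i)))).trace
        ∂(Measure.pi fun _ => μ) ≤
      ENNReal.ofReal (Real.exp (-((1 - Real.exp (-1)) / K)) ^ n * (NormedSpace.exp A).trace) := by
  induction n with
  | zero => simp
  | succ n ih =>
    have hmF : Measurable fun p : Ω × (Fin n → Ω) => ENNReal.ofReal (NormedSpace.exp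
        ((A - K⁻¹ • ∑ i, vecMulVec (φ (p.2 i)) (φ (p.2 i))) -
          K⁻¹ • vecMulVec (φ p.1) (φ p.1))).trace := by
      refine ENNReal.measurable_ofReal.comp (measurable_trace_exp fun i j => ?_)
      simp only [Matrix.sub_apply, Matrix.smul_apply, Matrix.sum_apply, vecMulVec_apply,
        smul_eq_mul]
      have h1 : ∀ i, Measurable fun p : Ω × (Fin n → Ω) => φ p.1 i := fun i =>
        (hmeas i).comp measurable_fst
      have h2 : ∀ k i, Measurable fun p : Ω × (Fin n → Ω) => φ (p.2 k) i := fun k i =>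
        (hmeas i).comp ((measurable_pi_apply k).comp measurable_snd)
      exact (measurable_const.sub ((Finset.measurable_sum _ fun k _ =>
        (h2 k i).mul (h2 k j)).const_mul _)).sub (((h1 i).mul (h1 j)).const_mul _)
    have hmp := measurePreserving_piFinSuccAbove (fun _ : Fin (n + 1) => μ) 0
    calc _ = ∫⁻ x : Fin (n + 1) → Ω, (fun p : Ω × (Fin n → Ω) =>
          ENNReal.ofReal (NormedSpace.exp
            ((A - K⁻¹ • ∑ i, vecMulVec (φ (p.2 i)) (φ (p.2 i))) -
              K⁻¹ • vecMulVec (φ p.1) (φ p.1))).trace)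
              (MeasurableEquiv.piFinSuccAbove (fun _ => Ω) 0 x) ∂(Measure.pi fun _ => μ) := by
          refine lintegral_congr fun x => ?_
          rw [Fin.sum_univ_succ, smul_add, add_comm (K⁻¹ • vecMulVec _ _), ← sub_sub]
          rfl
      _ = _ := hmp.lintegral_comp hmF
      _ = _ := lintegral_prod_symm _ hmF.aemeasurable
      _ ≤ ∫⁻ z : Fin n → Ω, ENNReal.ofReal (Real.exp (-((1 - Real.exp (-1)) / K))) *
            ENNReal.ofReal
            (NormedSpace.exp (A - K⁻¹ • ∑ i, vecMulVec (φ (z i)) (φ (z i)))).trace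
              ∂(Measure.pi fun _ => μ) := by
          refine lintegral_mono fun z => ?_
          rw [← ENNReal.ofReal_mul (Real.exp_pos _).le]
          refine lintegral_trace_exp_sub_le hK hφ hint horth (hA.sub (IsSymm.smul ?_ K⁻¹))
          rw [Matrix.IsSymm, transpose_sum]
          exact Finset.sum_congr rfl fun i _ => isSymm_vecMulVec_self _
      _ = ENNReal.ofReal (Real.exp (-((1 - Real.exp (-1)) / K))) * _ :=
          lintegral_const_mul' _ _ ENNReal.ofReal_ne_top
      _ ≤ _ := by
          refine (mul_le_mul_right ih _).trans ?_
          rw [← ENNReal.ofReal_mul (Real.exp_pos _).le, ← mul_assoc, ← pow_succ']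

/-- A lower tail matrix Chernoff bound: for i.i.d. samples, the quadratic form
`v ↦ ∑ i, (φ (x i) ⬝ᵥ v) ^ 2`, whose mean is `n` on the unit sphere, is at least `n / 4` on the unit
sphere, except on an event of probability at most `card d * exp (-(3 / 8) * n / K)`. -/
theorem measure_exists_sum_sq_lt_le {Ω : Type*} [MeasurableSpace Ω] {μ : Measure Ω}
    [IsProbabilityMeasure μ] {d : Type*} [Fintype d] [DecidableEq d] {φ : Ω → d → ℝ} {K : ℝ}
    (hK : 0 < K) (hmeas : ∀ i, Measurable fun y => φ y i)
    (hφ : ∀ᵐ y ∂μ, φ y ⬝ᵥ φ y ≤ K)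
    (hint : ∀ i j, Integrable (fun y => φ y i * φ y j) μ)
    (horth : ∀ i j, ∫ y, φ y i * φ y j ∂μ = if i = j then 1 else 0) (n : ℕ) :
    (Measure.pi fun _ : Fin n => μ)
        {x | ∃ v : d → ℝ, v ⬝ᵥ v = 1 ∧ ∑ i, (φ (x i) ⬝ᵥ v) ^ 2 < (n : ℝ) / 4} ≤
      ENNReal.ofReal (Fintype.card d * Real.exp (-(3 / 8) * (n / K))) := by
  set T : (Fin n → Ω) → ℝ := fun x =>
    (NormedSpace.exp (0 - K⁻¹ • ∑ i, vecMulVec (φ (x i)) (φ (x i)))).trace with hT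
  have hTm : Measurable T := by
    refine measurable_trace_exp fun i j => ?_
    simp only [Matrix.sub_apply, Matrix.smul_apply, Matrix.sum_apply, vecMulVec_apply,
        smul_eq_mul]
    have h2 : ∀ k i, Measurable fun p : Fin n → Ω => φ (p k) i := fun k i =>
      (hmeas i).comp (measurable_pi_apply k)
    exact measurable_const.sub ((Finset.measurable_sum _ fun k _ =>
        (h2 k i).mul (h2 k j)).const_mul _)
  have hsub : {x : Fin n → Ω | ∃ v : d → ℝ, v ⬝ᵥ v = 1 ∧
      ∑ i, (φ (x i) ⬝ᵥ v) ^ 2 < (n : ℝ) / 4} ⊆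
      {x | ENNReal.ofReal (Real.exp (-(n / K) / 4)) ≤ ENNReal.ofReal (T x)} := by
    rintro x ⟨v, hv, hx⟩
    refine ENNReal.ofReal_le_ofReal ?_
    have hsymm : (0 - K⁻¹ • ∑ i, vecMulVec (φ (x i)) (φ (x i))).IsSymm := by
      refine IsSymm.sub (by simp [Matrix.IsSymm]) (IsSymm.smul ?_ K⁻¹)
      rw [Matrix.IsSymm, transpose_sum]
      exact Finset.sum_congr rfl fun i _ => isSymm_vecMulVec_self _
    refine le_trans (Real.exp_le_exp.2 ?_) (exp_quadForm_le_trace_exp hsymm hv)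
    have hq : v ⬝ᵥ (0 - K⁻¹ • ∑ i, vecMulVec (φ (x i)) (φ (x i))) *ᵥ v =
        -(K⁻¹ * ∑ i, (φ (x i) ⬝ᵥ v) ^ 2) := by
      rw [zero_sub, neg_mulVec, dotProduct_neg, smul_mulVec, dotProduct_smul, smul_eq_mul,
        sum_mulVec, dotProduct_sum]
      congr 2
      refine Finset.sum_congr rfl fun i _ => ?_
      rw [vecMulVec_mulVec, dotProduct_smul, dotProduct_comm v]
      simp [pow_two]
    rw [hq]
    have h3 := mul_le_mul_of_nonneg_left hx.le (inv_pos.2 hK).le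
    have h4 : (n : ℝ) / K / 4 = K⁻¹ * (n / 4) := by ring
    linarith
  refine (measure_mono hsub).trans ?_
  refine (meas_ge_le_lintegral_div (ENNReal.measurable_ofReal.comp hTm).aemeasurable
    (ENNReal.ofReal_pos.2 (Real.exp_pos _)).ne' ENNReal.ofReal_ne_top).trans ?_
  have hmain := lintegral_pi_trace_exp_sub_sum_le hK hmeas hφ hint horth n
    (A := (0 : Matrix d d ℝ)) (by simp [Matrix.IsSymm])
  refine (ENNReal.div_le_div_right hmain _).trans ?_
  rw [← ENNReal.ofReal_div_of_pos (Real.exp_pos _)]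
  refine ENNReal.ofReal_le_ofReal ?_
  rw [NormedSpace.exp_zero, trace_one, ← Real.exp_nat_mul, mul_comm, mul_div_assoc, ← Real.exp_sub]
  refine mul_le_mul_of_nonneg_left (Real.exp_le_exp.2 ?_) (Nat.cast_nonneg _)
  have he : Real.exp (-1) ≤ 3 / 8 := by
    have := Real.exp_neg_one_lt_d9
    linarith
  have hnK : 0 ≤ (n : ℝ) / K := by positivity
  have h5 : (n : ℝ) * -((1 - Real.exp (-1)) / K) - -(n / K) / 4 =
    -(3 / 4 - Real.exp (-1)) * (n / K) := by ring
  rw [h5]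
  exact mul_le_mul_of_nonneg_right (by linarith) hnK

end

/-! ### Discrete least squares and its condition number -/

theorem empNorm_eq_norm {n : ℕ} (x : Fin n → ℝ) (v : ℝ → ℝ) :
    empNorm x v = Real.sqrt (1 / n) *
      ‖(WithLp.toLp 2 (fun i => v (x i)) : EuclideanSpace ℝ (Fin n))‖ := by
  rw [empNorm, EuclideanSpace.norm_eq, Real.sqrt_mul (by positivity)]
  simp

theorem empNorm_sq {n : ℕ} (x : Fin n → ℝ) (v : ℝ → ℝ) :
    empNorm x v ^ 2 = (1 / (n : ℝ)) * ∑ i, v (x i) ^ 2 := by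
  rw [empNorm, Real.sq_sqrt (by positivity)]
  simp

theorem empNorm_nonneg {n : ℕ} (x : Fin n → ℝ) (v : ℝ → ℝ) : 0 ≤ empNorm x v :=
  Real.sqrt_nonneg _

theorem empNorm_const_mul {n : ℕ} (x : Fin n → ℝ) (c : ℝ) (v : ℝ → ℝ) :
    empNorm x (fun t => c * v t) = |c| * empNorm x v := by
  have h : (WithLp.toLp 2 (fun i => c * v (x i)) : EuclideanSpace ℝ (Fin n)) =
      c • WithLp.toLp 2 (fun i => v (x i)) := by
    ext i; simp
  rw [empNorm_eq_norm, empNorm_eq_norm, h, norm_smul, Real.norm_eq_abs]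
  ring

theorem l2Norm_smul (ρ : Measure ℝ) (c : ℝ) (p : ℝ[X]) : l2Norm ρ (c • p) = |c| * l2Norm ρ p := by
  rw [l2Norm, l2Norm, ← Real.sqrt_sq_eq_abs c, ← Real.sqrt_mul (sq_nonneg c),
    ← integral_const_mul]
  simp [abs_mul, mul_pow]

/-- Evaluation of polynomials at the sampling points, with values in Euclidean space. -/
def sampleEval {n : ℕ} (x : Fin n → ℝ) : ℝ[X] →ₗ[ℝ] EuclideanSpace ℝ (Fin n) :=
  (WithLp.linearEquiv 2 ℝ (Fin n → ℝ)).symm.toLinearMap ∘ₗ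
    LinearMap.pi fun i => Polynomial.leval (x i)

theorem exists_isLeastSquares (m : ℕ) {n : ℕ} (x : Fin n → ℝ) (f : ℝ → ℝ) :
    ∃ p, IsLeastSquares m x f p := by
  set W := (Polynomial.degreeLE ℝ m).map (sampleEval x)
  set u : EuclideanSpace ℝ (Fin n) := WithLp.toLp 2 fun i => f (x i) with hu
  obtain ⟨v, ⟨p, hp, rfl⟩, hv⟩ :=
    W.exists_norm_eq_iInf_of_complete_subspace (Submodule.complete_of_finiteDimensional W) u
  have hnorm : ∀ q : ℝ[X], empNorm x (fun t => q.eval t - f t) =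
      Real.sqrt (1 / n) * ‖u - sampleEval x q‖ := by
    intro q
    rw [empNorm_eq_norm, norm_sub_rev]
    congr 2
  refine ⟨p, hp, fun q hq => ?_⟩
  rw [hnorm, hnorm, hv]
  refine mul_le_mul_of_nonneg_left ?_ (Real.sqrt_nonneg _)
  exact ciInf_le ⟨0, by rintro _ ⟨w, rfl⟩; exact norm_nonneg _⟩
    (⟨sampleEval x q, q, hq, rfl⟩ : W)

theorem isLeastSquares_leastSquares (m : ℕ) {n : ℕ} (x : Fin n → ℝ) (f : ℝ → ℝ) :
    IsLeastSquares m x f (leastSquares m x f) :=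
  Classical.epsilon_spec (exists_isLeastSquares m x f)

/-- The normal equations: the residual of a least squares fit is orthogonal to all polynomials of
degree at most `m`. -/
theorem IsLeastSquares.sum_mul_eq_zero {m n : ℕ} {x : Fin n → ℝ} {f : ℝ → ℝ} {p : ℝ[X]}
    (hp : IsLeastSquares m x f p) {q : ℝ[X]} (hq : q ∈ Polynomial.degreeLE ℝ m) :
    ∑ i, (p.eval (x i) - f (x i)) * q.eval (x i) = 0 := by
  rcases Nat.eq_zero_or_pos n with rfl | hn
  · simp
  have hn0 : (0 : ℝ) < n := by exact_mod_cast hn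
  have hvar : ∀ t : ℝ, 0 ≤ (∑ i, q.eval (x i) ^ 2) * (t * t) +
      (2 * ∑ i, (p.eval (x i) - f (x i)) * q.eval (x i)) * t + 0 := by
    intro t
    have h1 := hp.2 (p + t • q) (Submodule.add_mem _ hp.1 (Submodule.smul_mem _ t hq))
    have h2 := pow_le_pow_left₀ (empNorm_nonneg _ _) h1 2
    rw [empNorm_sq, empNorm_sq] at h2
    have h3 := le_of_mul_le_mul_left h2 (by positivity)
    have h4 : ∑ i, ((p + t • q).eval (x i) - f (x i)) ^ 2 =
        ∑ i, (p.eval (x i) - f (x i)) ^ 2 + ((∑ i, q.eval (x i) ^ 2) * (t * t) +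
        (2 * ∑ i, (p.eval (x i) - f (x i)) * q.eval (x i)) * t) := by
      simp only [Finset.mul_sum, Finset.sum_mul, ← Finset.sum_add_distrib]
      refine Finset.sum_congr rfl fun i _ => ?_
      simp only [Polynomial.eval_add, Polynomial.eval_smul, smul_eq_mul]
      ring
    linarith
  have h := discrim_le_zero hvar
  rw [discrim] at h
  nlinarith [sq_nonneg (∑ i, (p.eval (x i) - f (x i)) * q.eval (x i))]

theorem sum_leastSquares_add_sub_mul_eq_zero (m : ℕ) {n : ℕ} (x : Fin n → ℝ) (f h : ℝ → ℝ)
    {q : ℝ[X]} (hq : q ∈ Polynomial.degreeLE ℝ m) :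
    ∑ i, ((leastSquares m x (fun t => f t + h t) - leastSquares m x f).eval (x i) - h (x i)) *
      q.eval (x i) = 0 := by
  have h1 := (isLeastSquares_leastSquares m x (fun t => f t + h t)).sum_mul_eq_zero hq
  have h2 := (isLeastSquares_leastSquares m x f).sum_mul_eq_zero hq
  have h3 := congrArg₂ (· - ·) h1 h2
  simp only [← Finset.sum_sub_distrib, sub_zero] at h3
  rw [← h3]
  refine Finset.sum_congr rfl fun i _ => ?_
  rw [Polynomial.eval_sub]
  ring

theorem leastSquares_sub_mem (m : ℕ) {n : ℕ} (x : Fin n → ℝ) (f g : ℝ → ℝ) :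
    leastSquares m x g - leastSquares m x f ∈ Polynomial.degreeLE ℝ m :=
  Submodule.sub_mem _ (isLeastSquares_leastSquares m x g).1 (isLeastSquares_leastSquares m x f).1

/-- A norm comparison on polynomials bounds the condition number: the empirical norm of the change
of the fit is at most that of the perturbation. -/
theorem condNumber_le {ρ : Measure ℝ} {m n : ℕ} {x : Fin n → ℝ} {C : ℝ} (hC : 0 ≤ C)
    (h : ∀ p ∈ Polynomial.degreeLE ℝ m, l2Norm ρ p ≤ C * empNorm x fun t => p.eval t) :
    condNumber ρ m x ≤ ENNReal.ofReal C := by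
  refine iSup_le fun f => iInf₂_le_of_le 1 one_pos (iSup₂_le fun g hg => ?_)
  refine ENNReal.ofReal_le_ofReal ((div_le_iff₀ hg.1).2 ?_)
  set d := leastSquares m x (fun t => f t + g t) - leastSquares m x f with hd
  refine (h d (leastSquares_sub_mem m x _ _)).trans (mul_le_mul_of_nonneg_left ?_ hC)
  have horth := sum_leastSquares_add_sub_mul_eq_zero m x f g (leastSquares_sub_mem m x f
    (fun t => f t + g t))
  rw [← hd] at horth
  refine (sq_le_sq₀ (empNorm_nonneg _ _) (empNorm_nonneg _ _)).1 ?_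
  rw [empNorm_sq, empNorm_sq]
  refine mul_le_mul_of_nonneg_left ?_ (by positivity)
  have h2 : ∑ i, (g (x i) ^ 2 - d.eval (x i) ^ 2) = ∑ i, (g (x i) - d.eval (x i)) ^ 2 := by
    have h3 : ∑ i, (g (x i) ^ 2 - d.eval (x i) ^ 2) - ∑ i, (g (x i) - d.eval (x i)) ^ 2 =
        (-2) * ∑ i, (d.eval (x i) - g (x i)) * d.eval (x i) := by
      rw [← Finset.sum_sub_distrib, Finset.mul_sum]
      exact Finset.sum_congr rfl fun i _ => by ring
    rw [horth] at h3
    linarith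
  have h4 : 0 ≤ ∑ i, (g (x i) - d.eval (x i)) ^ 2 := Finset.sum_nonneg fun i _ => sq_nonneg _
  rw [← h2, Finset.sum_sub_distrib] at h4
  linarith

theorem eq_zero_of_eval_sample_eq_zero {m n : ℕ} (hmn : m < n) {x : Fin n → ℝ}
    (hx : Function.Injective x) {p : ℝ[X]} (hp : p ∈ Polynomial.degreeLE ℝ m)
    (h : ∀ i, p.eval (x i) = 0) : p = 0 := by
  refine Polynomial.eq_zero_of_natDegree_lt_card_of_eval_eq_zero p hx h ?_
  rw [Fintype.card_fin]
  exact (Polynomial.natDegree_le_of_degree_le (Polynomial.mem_degreeLE.1 hp)).trans_lt hmn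

/-- Conversely, at distinct sampling points a bound on the condition number is a norm comparison
on polynomials: perturbing `f = 0` by small multiples of `p` changes the fit by the same
multiples of `p`. -/
theorem l2Norm_le_of_condNumber_le {ρ : Measure ℝ} {m n : ℕ} (hmn : m < n) {x : Fin n → ℝ}
    (hx : Function.Injective x) {K : ℝ} (hK : 0 ≤ K) (h : condNumber ρ m x ≤ ENNReal.ofReal K)
    {p : ℝ[X]} (hp : p ∈ Polynomial.degreeLE ℝ m) :
    l2Norm ρ p ≤ K * empNorm x fun t => p.eval t := by
  rcases (empNorm_nonneg x fun t => p.eval t).eq_or_lt with h0 | h0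
  · have hp0 : p = 0 := by
      refine eq_zero_of_eval_sample_eq_zero hmn hx hp fun i => ?_
      have h1 := empNorm_sq x fun t => p.eval t
      have hn0 : (0 : ℝ) < n := by exact_mod_cast (Nat.zero_le m).trans_lt hmn
      rw [← h0, eq_comm, zero_pow two_ne_zero, mul_eq_zero] at h1
      have h2 := h1.resolve_left (by positivity)
      rw [Finset.sum_eq_zero_iff_of_nonneg fun i _ => sq_nonneg _] at h2
      exact pow_eq_zero_iff two_ne_zero |>.1 (h2 i (Finset.mem_univ i))
    subst hp0
    simp [l2Norm, empNorm]
  rw [← div_le_iff₀ h0]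
  refine (ENNReal.ofReal_le_ofReal_iff hK).1 (le_trans ?_ h)
  refine le_trans ?_ (le_iSup _ (fun _ : ℝ => (0 : ℝ)))
  refine le_iInf₂ fun δ hδ => ?_
  set e := empNorm x fun t => p.eval t with he
  have ht : 0 < δ / e := div_pos hδ h0
  have hemp : empNorm x (fun t => δ / e * p.eval t) = δ := by
    rw [empNorm_const_mul, abs_of_pos ht, ← he, div_mul_cancel₀ _ h0.ne']
  refine le_trans ?_ (le_iSup₂ (fun t => δ / e * p.eval t) ⟨?_, hemp.le⟩)
  swap
  · rw [hemp]; exact hδ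
  set d := leastSquares m x (fun t => (0 : ℝ) + δ / e * p.eval t) -
    leastSquares m x (fun _ => (0 : ℝ)) with hd
  have hdmem : d - (δ / e) • p ∈ Polynomial.degreeLE ℝ m :=
    Submodule.sub_mem _ (leastSquares_sub_mem m x _ _) (Submodule.smul_mem _ _ hp)
  have horth := sum_leastSquares_add_sub_mul_eq_zero m x (fun _ => (0 : ℝ))
    (fun t => δ / e * p.eval t) hdmem
  rw [← hd] at horth
  have hdp : d - (δ / e) • p = 0 := by
    refine eq_zero_of_eval_sample_eq_zero hmn hx hdmem fun i => ?_
    have h1 : ∑ i, (d - (δ / e) • p).eval (x i) ^ 2 = 0 := by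
      rw [← horth]
      refine Finset.sum_congr rfl fun i _ => ?_
      simp only [Polynomial.eval_sub, Polynomial.eval_smul, smul_eq_mul]
      ring
    rw [Finset.sum_eq_zero_iff_of_nonneg fun i _ => sq_nonneg _] at h1
    exact pow_eq_zero_iff two_ne_zero |>.1 (h1 i (Finset.mem_univ i))
  rw [sub_eq_zero.1 hdp, hemp, l2Norm_smul, abs_of_pos ht]
  refine ENNReal.ofReal_le_ofReal (le_of_eq ?_)
  field_simp

/-! ### The Jacobi measure -/

theorem intervalIntegrable_one_sub_rpow {α : ℝ} (hα : -1 < α) (a b : ℝ) :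
    IntervalIntegrable (fun t : ℝ => (1 - t) ^ α) volume a b := by
  have h := (intervalIntegral.intervalIntegrable_rpow' (a := 1 - a) (b := 1 - b) hα).comp_sub_left 1
  simpa using h

theorem integrableOn_weight {α β : ℝ} (hα : -1 < α) (hβ : -1 < β) :
    IntegrableOn (fun t : ℝ => (1 - t) ^ α * (1 + t) ^ β) (Set.Icc (-1) 1) := by
  have h1 : ∀ {α β : ℝ}, -1 < α →
      IntervalIntegrable (fun t : ℝ => (1 - t) ^ α * (1 + t) ^ β) volume 0 1 := by
    intro α β hα
    refine (intervalIntegrable_one_sub_rpow hα 0 1).mul_continuousOn ?_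
    refine ContinuousOn.rpow_const (by fun_prop) fun t ht => Or.inl ?_
    rw [Set.uIcc_of_le zero_le_one] at ht
    linarith [ht.1]
  have h2 : IntervalIntegrable (fun t : ℝ => (1 - t) ^ α * (1 + t) ^ β) volume (-1) 0 := by
    have h := (h1 (α := β) (β := α) hβ).comp_sub_left 0
    simp only [zero_sub, sub_zero, sub_neg_eq_add, ← sub_eq_add_neg] at h
    refine h.symm.congr fun t _ => mul_comm _ _
  rw [← intervalIntegrable_iff_integrableOn_Icc_of_le (by norm_num)]
  exact h2.trans (h1 hα)

theorem integral_weight_pos {α β : ℝ} (hα : -1 < α) (hβ : -1 < β) :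
    0 < ∫ t in Set.Icc (-1 : ℝ) 1, (1 - t) ^ α * (1 + t) ^ β := by
  rw [integral_Icc_eq_integral_Ioc, ← intervalIntegral.integral_of_le (by norm_num)]
  refine intervalIntegral.intervalIntegral_pos_of_pos_on
    ((intervalIntegrable_iff_integrableOn_Icc_of_le (by norm_num)).2 (integrableOn_weight hα hβ))
    (fun t ht => mul_pos (Real.rpow_pos_of_pos (by linarith [ht.2]) _)
      (Real.rpow_pos_of_pos (by linarith [ht.1]) _)) (by norm_num)

theorem jacobiConst_pos {α β : ℝ} (hα : -1 < α) (hβ : -1 < β) : 0 < jacobiConst α β :=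
  inv_pos.2 (integral_weight_pos hα hβ)

theorem isProbabilityMeasure_jacobiMeasure {α β : ℝ} (hα : -1 < α) (hβ : -1 < β) :
    IsProbabilityMeasure (jacobiMeasure α β) := by
  refine ⟨?_⟩
  rw [jacobiMeasure, withDensity_apply _ MeasurableSet.univ, Measure.restrict_univ]
  refine (ofReal_integral_eq_lintegral_ofReal (f := jacobiWeight α β)
    ((integrableOn_weight hα hβ).const_mul _) ?_).symm.trans ?_
  rotate_left
  · simp only [jacobiWeight]
    rw [integral_const_mul, jacobiConst, inv_mul_cancel₀ (integral_weight_pos hα hβ).ne',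
      ENNReal.ofReal_one]
  · filter_upwards [ae_restrict_mem measurableSet_Icc] with t ht
    exact mul_nonneg (jacobiConst_pos hα hβ).le (mul_nonneg
      (Real.rpow_nonneg (by linarith [ht.2]) _) (Real.rpow_nonneg (by linarith [ht.1]) _))

theorem ae_mem_Icc_jacobiMeasure (α β : ℝ) :
    ∀ᵐ t ∂(jacobiMeasure α β), t ∈ Set.Icc (-1 : ℝ) 1 :=
  (withDensity_absolutelyContinuous _ _).ae_le (ae_restrict_mem measurableSet_Icc)

theorem nullSingletonClass_jacobiMeasure (α β : ℝ) : NullSingletonClass (jacobiMeasure α β) :=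
  ⟨fun x => (withDensity_absolutelyContinuous _ _)
    (Measure.restrict_le_self.absolutelyContinuous (measure_singleton x))⟩

theorem measurable_jacobiWeight (α β : ℝ) : Measurable (jacobiWeight α β) := by
  unfold jacobiWeight
  fun_prop

theorem jacobiConst_comm (α β : ℝ) : jacobiConst α β = jacobiConst β α := by
  unfold jacobiConst
  rw [integral_Icc_eq_integral_Ioc, ← intervalIntegral.integral_of_le (by norm_num),
    integral_Icc_eq_integral_Ioc, ← intervalIntegral.integral_of_le (by norm_num)]
  have h := intervalIntegral.integral_comp_neg (a := -1) (b := 1)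
    (fun t : ℝ => (1 - t) ^ α * (1 + t) ^ β)
  rw [neg_neg] at h
  rw [← h]
  congr 1
  refine intervalIntegral.integral_congr fun t _ => ?_
  simp only [sub_neg_eq_add, ← sub_eq_add_neg]
  exact mul_comm _ _

/-- The reflection `t ↦ -t` exchanges the two exponents. -/
theorem measurePreserving_neg_jacobiMeasure (α β : ℝ) :
    MeasurePreserving (fun t : ℝ => -t) (jacobiMeasure α β) (jacobiMeasure β α) := by
  refine ⟨measurable_neg, ?_⟩
  ext S hS
  have hneg : MeasurePreserving (fun t : ℝ => -t) (volume : Measure ℝ) volume :=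
    Measure.measurePreserving_neg volume
  rw [Measure.map_apply measurable_neg hS, jacobiMeasure, jacobiMeasure, withDensity_apply _ hS,
    withDensity_apply _ (measurable_neg hS), Measure.restrict_restrict hS,
    Measure.restrict_restrict (measurable_neg hS),
    ← hneg.setLIntegral_comp_preimage (hS.inter measurableSet_Icc)
      (measurable_jacobiWeight β α).ennreal_ofReal]
  have hset : (fun t : ℝ => -t) ⁻¹' S ∩ Set.Icc (-1 : ℝ) 1 =
      (fun t : ℝ => -t) ⁻¹' (S ∩ Set.Icc (-1 : ℝ) 1) := by
    ext t
    simp only [Set.mem_inter_iff, Set.mem_preimage, Set.mem_Icc]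
    constructor <;> rintro ⟨h1, h2, h3⟩ <;> exact ⟨h1, by linarith, by linarith⟩
  rw [hset]
  refine lintegral_congr fun t => ?_
  simp only [jacobiWeight, sub_neg_eq_add, ← sub_eq_add_neg, jacobiConst_comm α β]
  rw [mul_comm ((1 - t) ^ α)]

theorem integrable_eval_jacobiMeasure {α β : ℝ} (hα : -1 < α) (hβ : -1 < β) (p : ℝ[X]) :
    Integrable (fun t => p.eval t) (jacobiMeasure α β) := by
  have := isProbabilityMeasure_jacobiMeasure hα hβ
  obtain ⟨C, hC⟩ := isCompact_Icc.exists_bound_of_continuousOn (s := Set.Icc (-1 : ℝ) 1)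
    p.continuous.continuousOn
  refine Integrable.of_bound p.continuous.aestronglyMeasurable C ?_
  filter_upwards [ae_mem_Icc_jacobiMeasure α β] with t ht
  exact hC t ht

theorem integral_sq_eval_nonneg (ρ : Measure ℝ) (p : ℝ[X]) : 0 ≤ ∫ t, p.eval t ^ 2 ∂ρ :=
  integral_nonneg fun _ => sq_nonneg _

theorem integrable_sq_eval_jacobiMeasure {α β : ℝ} (hα : -1 < α) (hβ : -1 < β) (p : ℝ[X]) :
    Integrable (fun t => p.eval t ^ 2) (jacobiMeasure α β) := by
  have h := integrable_eval_jacobiMeasure hα hβ (p ^ 2)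
  simp only [Polynomial.eval_pow] at h
  exact h

theorem eq_zero_of_integral_sq_eval_eq_zero {α β : ℝ} (hα : -1 < α) (hβ : -1 < β) {p : ℝ[X]}
    (h : ∫ t, p.eval t ^ 2 ∂(jacobiMeasure α β) = 0) : p = 0 := by
  have := isProbabilityMeasure_jacobiMeasure hα hβ
  have := nullSingletonClass_jacobiMeasure α β
  by_contra hp
  rw [integral_eq_zero_iff_of_nonneg (fun _ => sq_nonneg _)
    (integrable_sq_eval_jacobiMeasure hα hβ p)] at h
  have h0 : ∀ᵐ t ∂(jacobiMeasure α β), t ∉ (p.roots.toFinset : Set ℝ) :=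
    measure_eq_zero_iff_ae_notMem.1 ((p.roots.toFinset.finite_toSet).measure_zero _)
  obtain ⟨t, ht, ht2⟩ := (h.and h0).exists
  refine ht2 ?_
  simpa [hp] using ht

/-- An orthonormal basis of the polynomials of degree at most `m` for the Jacobi weight. -/
theorem exists_orthonormal_polynomials {α β : ℝ} (hα : -1 < α) (hβ : -1 < β) (m : ℕ) :
    ∃ φ : Fin (m + 1) → ℝ[X], (∀ i, φ i ∈ Polynomial.degreeLE ℝ m) ∧
      (∀ i j, ∫ t, (φ i).eval t * (φ j).eval t ∂(jacobiMeasure α β) = if i = j then 1 else 0) ∧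
      ∀ p ∈ Polynomial.degreeLE ℝ m, ∃ c : Fin (m + 1) → ℝ, p = ∑ i, c i • φ i := by
  have hmem : ∀ p : ℝ[X], p ∈ Polynomial.degreeLT ℝ (m + 1) ↔ p ∈ Polynomial.degreeLE ℝ m :=
    fun p => by rw [Polynomial.degreeLT_succ_eq_degreeLE]
  have hint : ∀ p q : ℝ[X], Integrable (fun t => p.eval t * q.eval t) (jacobiMeasure α β) :=
    fun p q => by simpa using integrable_eval_jacobiMeasure hα hβ (p * q)
  let core : InnerProductSpace.Core ℝ (Polynomial.degreeLT ℝ (m + 1)) :=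
    { inner := fun p q => ∫ t, (p : ℝ[X]).eval t * (q : ℝ[X]).eval t ∂(jacobiMeasure α β)
      conj_inner_symm := fun p q => by
        simp [mul_comm]
      re_inner_nonneg := fun p => by
        simpa [← pow_two] using integral_sq_eval_nonneg (jacobiMeasure α β) p
      add_left := fun p q r => by
        simp only [Submodule.coe_add, Polynomial.eval_add, add_mul]
        exact integral_add (hint _ _) (hint _ _)
      smul_left := fun p q r => by
        simp [mul_assoc, integral_const_mul]
      definite := fun p hp => by
        refine Subtype.ext (eq_zero_of_integral_sq_eval_eq_zero hα hβ ?_)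
        simpa [← pow_two] using hp }
  let _ : NormedAddCommGroup (Polynomial.degreeLT ℝ (m + 1)) := core.toNormedAddCommGroup
  let _ : InnerProductSpace ℝ (Polynomial.degreeLT ℝ (m + 1)) :=
    InnerProductSpace.ofCore core.toCore
  have hfin : Module.finrank ℝ (Polynomial.degreeLT ℝ (m + 1)) = m + 1 := by
    rw [(Polynomial.degreeLTEquiv ℝ (m + 1)).finrank_eq, Module.finrank_fin_fun]
  have : FiniteDimensional ℝ (Polynomial.degreeLT ℝ (m + 1)) :=
    (Polynomial.degreeLTEquiv ℝ (m + 1)).symm.finiteDimensional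
  let b := (stdOrthonormalBasis ℝ (Polynomial.degreeLT ℝ (m + 1))).reindex (finCongr hfin)
  refine ⟨fun i => b i, fun i => (hmem _).1 (b i).2, fun i j => ?_, fun p hp => ?_⟩
  · exact (orthonormal_iff_ite.1 b.orthonormal) i j
  · refine ⟨fun i => b.repr ⟨p, (hmem p).2 hp⟩ i, ?_⟩
    have h := b.sum_repr ⟨p, (hmem p).2 hp⟩
    have h2 := congrArg (Polynomial.degreeLT ℝ (m + 1)).subtype h
    rw [map_sum] at h2
    exact h2.symm

/-! ### Bernstein's inequality -/

/-- The polynomial `z ^ m * p ((z + z⁻¹) / 2)`, written without division by `z`. On the unit circle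
its modulus is that of `p` at the real part of `z`. -/
def joukowskyLift (p : ℝ[X]) (m : ℕ) (z : ℂ) : ℂ :=
  ∑ k ∈ Finset.range (m + 1), (p.coeff k : ℂ) * ((z ^ 2 + 1) / 2) ^ k * z ^ (m - k)

theorem joukowskyLift_eq (p : ℝ[X]) (m : ℕ) {z : ℂ} (hz : z ≠ 0) :
    joukowskyLift p m z =
      z ^ m * ∑ k ∈ Finset.range (m + 1), (p.coeff k : ℂ) * ((z + z⁻¹) / 2) ^ k := by
  rw [joukowskyLift, Finset.mul_sum]
  refine Finset.sum_congr rfl fun k hk => ?_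
  have hk' : k ≤ m := Nat.lt_succ_iff.1 (Finset.mem_range.1 hk)
  have h1 : z ^ m = z ^ k * z ^ (m - k) := by rw [← pow_add, Nat.add_sub_cancel' hk']
  have h2 : (z ^ 2 + 1) / 2 = z * ((z + z⁻¹) / 2) := by
    field_simp
  rw [h1, h2, mul_pow]
  ring

/-- The lift is self-reciprocal, which transfers bounds from the unit disc to its exterior. -/
theorem joukowskyLift_inv (p : ℝ[X]) (m : ℕ) {z : ℂ} (hz : z ≠ 0) :
    joukowskyLift p m z = z ^ (2 * m) * joukowskyLift p m z⁻¹ := by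
  rw [joukowskyLift_eq p m hz, joukowskyLift_eq p m (inv_ne_zero hz), inv_inv, add_comm z⁻¹ z,
    ← mul_assoc, inv_pow, two_mul, pow_add, mul_assoc (z ^ m), mul_inv_cancel₀ (pow_ne_zero _ hz),
    mul_one]

theorem joukowskyLift_exp {p : ℝ[X]} {m : ℕ} (hp : p.natDegree ≤ m) (θ : ℝ) :
    joukowskyLift p m (Complex.exp (θ * Complex.I)) =
      Complex.exp (θ * Complex.I) ^ m * ((p.eval (Real.cos θ) : ℝ) : ℂ) := by
  rw [joukowskyLift_eq p m (Complex.exp_ne_zero _),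
    Polynomial.eval_eq_sum_range' (Nat.lt_succ_of_le hp)]
  have h : (Complex.exp (θ * Complex.I) + (Complex.exp (θ * Complex.I))⁻¹) / 2 =
      ((Real.cos θ : ℝ) : ℂ) := by
    rw [← Complex.exp_neg, Complex.ofReal_cos, Complex.cos, neg_mul]
  rw [h]
  push_cast
  rfl

theorem differentiable_joukowskyLift (p : ℝ[X]) (m : ℕ) :
    Differentiable ℂ (joukowskyLift p m) := by
  unfold joukowskyLift
  fun_prop

theorem norm_joukowskyLift_le {p : ℝ[X]} {m : ℕ} (hp : p.natDegree ≤ m) {M : ℝ}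
    (hM : ∀ t ∈ Set.Icc (-1 : ℝ) 1, |p.eval t| ≤ M) {R : ℝ} (hR : 1 ≤ R) {z : ℂ} (hz : ‖z‖ ≤ R) :
    ‖joukowskyLift p m z‖ ≤ R ^ (2 * m) * M := by
  have hM0 : 0 ≤ M := (abs_nonneg _).trans (hM 0 (by norm_num))
  have hcirc : ∀ w : ℂ, ‖w‖ = 1 → ‖joukowskyLift p m w‖ ≤ M := by
    intro w hw
    have hw' : w = Complex.exp (w.arg * Complex.I) := by
      conv_lhs => rw [← Complex.norm_mul_exp_arg_mul_I w, hw, Complex.ofReal_one, one_mul]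
    rw [hw', joukowskyLift_exp hp, norm_mul, norm_pow, Complex.norm_exp_ofReal_mul_I, one_pow,
      one_mul, Complex.norm_real, Real.norm_eq_abs]
    exact hM _ ⟨Real.neg_one_le_cos _, Real.cos_le_one _⟩
  have hdisc : ∀ w : ℂ, ‖w‖ ≤ 1 → ‖joukowskyLift p m w‖ ≤ M := by
    intro w hw
    refine Complex.norm_le_of_forall_mem_frontier_norm_le (U := Metric.ball (0 : ℂ) 1)
      Metric.isBounded_ball (differentiable_joukowskyLift p m).diffContOnCl (fun v hv => ?_) ?_
    · rw [frontier_ball _ one_ne_zero] at hv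
      exact hcirc v (by simpa using hv)
    · rw [closure_ball _ one_ne_zero]
      simpa using hw
  have hRp : 1 ≤ R ^ (2 * m) := one_le_pow₀ hR
  rcases le_total ‖z‖ 1 with h | h
  · exact (hdisc z h).trans (le_mul_of_one_le_left hM0 hRp)
  · have hz0 : z ≠ 0 := norm_pos_iff.1 (one_pos.trans_le h)
    rw [joukowskyLift_inv p m hz0, norm_mul, norm_pow]
    refine mul_le_mul (pow_le_pow_left₀ (norm_nonneg _) hz _) (hdisc _ ?_) (norm_nonneg _)
      (by positivity)
    rw [norm_inv]
    exact inv_le_one_of_one_le₀ h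

theorem norm_deriv_joukowskyLift_le {p : ℝ[X]} {m : ℕ} (hm : 1 ≤ m) (hp : p.natDegree ≤ m) {M : ℝ}
    (hM : ∀ t ∈ Set.Icc (-1 : ℝ) 1, |p.eval t| ≤ M) {z : ℂ} (hz : ‖z‖ = 1) :
    ‖deriv (joukowskyLift p m) z‖ ≤ 8 * m * M := by
  have hM0 : 0 ≤ M := (abs_nonneg _).trans (hM 0 (by norm_num))
  have hm0 : (0 : ℝ) < m := by exact_mod_cast hm
  have hR : (0 : ℝ) < 1 / m := by positivity
  have h1 := Complex.norm_deriv_le_of_forall_mem_sphere_norm_le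
    (C := (1 + 1 / (m : ℝ)) ^ (2 * m) * M)
    hR (differentiable_joukowskyLift p m).diffContOnCl (fun w hw => ?_) (c := z)
  · refine h1.trans ?_
    have h2 : (1 + 1 / (m : ℝ)) ^ (2 * m) ≤ 8 := by
      have h3 : (1 + 1 / (m : ℝ)) ≤ Real.exp (1 / m) := by
        have := Real.add_one_le_exp (1 / (m : ℝ)); linarith
      calc (1 + 1 / (m : ℝ)) ^ (2 * m) ≤ Real.exp (1 / m) ^ (2 * m) :=
            pow_le_pow_left₀ (by positivity) h3 _
        _ = Real.exp 1 ^ 2 := by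
            rw [← Real.exp_nat_mul, ← Real.exp_nat_mul]
            congr 1
            push_cast
            field_simp
        _ ≤ 2.7182818286 ^ 2 := pow_le_pow_left₀ (Real.exp_pos _).le Real.exp_one_lt_d9.le _
        _ ≤ 8 := by norm_num
    rw [div_div_eq_mul_div, div_one]
    nlinarith [mul_le_mul_of_nonneg_right h2 (mul_nonneg hM0 hm0.le)]
  · refine norm_joukowskyLift_le hp hM (by linarith) ?_
    have h4 : ‖w - z‖ = 1 / m := by simpa [dist_eq_norm] using hw
    calc ‖w‖ = ‖z + (w - z)‖ := by rw [add_sub_cancel]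
      _ ≤ ‖z‖ + ‖w - z‖ := norm_add_le _ _
      _ = _ := by rw [hz, h4]

/-- A form of Bernstein's inequality, without the sharp constant: `θ ↦ p (cos θ)` is Lipschitz with
constant proportional to the degree and to the maximum of `|p|`. It follows from the maximum
principle and Cauchy's estimate on circles of radius `1 / m` around points of the unit circle. -/
theorem abs_eval_cos_sub_le {p : ℝ[X]} {m : ℕ} (hm : 1 ≤ m) (hp : p.natDegree ≤ m) {M : ℝ}
    (hM : ∀ t ∈ Set.Icc (-1 : ℝ) 1, |p.eval t| ≤ M) (θ θ' : ℝ) :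
    |p.eval (Real.cos θ) - p.eval (Real.cos θ')| ≤ 9 * m * M * |θ - θ'| := by
  have hder_e : ∀ (c : ℝ) (θ : ℝ), HasDerivAt (fun θ : ℝ => Complex.exp (θ * (c * Complex.I)))
      (Complex.exp (θ * (c * Complex.I)) * (c * Complex.I)) θ := by
    intro c θ
    have h1 : HasDerivAt (fun θ : ℝ => (θ : ℂ) * (c * Complex.I)) (c * Complex.I) θ := by
      simpa using (Complex.ofRealCLM.hasDerivAt (x := θ)).mul_const ((c : ℂ) * Complex.I)
    exact h1.cexp
  -- undoing the rotation `exp (i m θ)` recovers `p (cos θ)` from the lift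
  have hform : ∀ θ : ℝ, ((p.eval (Real.cos θ) : ℝ) : ℂ) =
      Complex.exp (θ * ((-m : ℝ) * Complex.I)) *
        joukowskyLift p m (Complex.exp (θ * ((1 : ℝ) * Complex.I))) := by
    intro θ
    rw [Complex.ofReal_one, one_mul, joukowskyLift_exp hp, ← mul_assoc, ← Complex.exp_nat_mul,
      ← Complex.exp_add]
    have : (θ : ℂ) * (((-m : ℝ) : ℂ) * Complex.I) + m * (θ * Complex.I) = 0 := by
      push_cast; ring
    rw [this, Complex.exp_zero, one_mul]
  have hnorm : ∀ (c θ : ℝ), ‖Complex.exp (θ * (c * Complex.I))‖ = 1 := by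
    intro c θ
    rw [← mul_assoc, ← Complex.ofReal_mul, Complex.norm_exp_ofReal_mul_I]
  have hder : ∀ θ : ℝ, HasDerivAt (fun θ : ℝ => ((p.eval (Real.cos θ) : ℝ) : ℂ))
      (Complex.exp (θ * ((-m : ℝ) * Complex.I)) * ((-m : ℝ) * Complex.I) *
        joukowskyLift p m (Complex.exp (θ * ((1 : ℝ) * Complex.I))) +
        Complex.exp (θ * ((-m : ℝ) * Complex.I)) *
          (deriv (joukowskyLift p m) (Complex.exp (θ * ((1 : ℝ) * Complex.I))) *
            (Complex.exp (θ * ((1 : ℝ) * Complex.I)) * ((1 : ℝ) * Complex.I)))) θ := by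
    intro θ
    simp only [hform]
    have h1 := ((differentiable_joukowskyLift p m).differentiableAt
      (x := Complex.exp (θ * ((1 : ℝ) * Complex.I)))).hasDerivAt
    have h2 := HasDerivAt.comp (h₂ := joukowskyLift p m) θ h1 (hder_e 1 θ)
    exact (hder_e (-m) θ).mul h2
  have hlip := Convex.norm_image_sub_le_of_norm_hasDerivWithin_le (s := Set.univ)
    (C := 9 * m * M) (fun θ _ => (hder θ).hasDerivWithinAt) (fun θ _ => ?_) convex_univ
    (Set.mem_univ θ') (Set.mem_univ θ)
  · rw [← Complex.ofReal_sub, Complex.norm_real, Real.norm_eq_abs, Real.norm_eq_abs] at hlip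
    exact hlip
  · refine (norm_add_le _ _).trans ?_
    simp only [norm_mul, hnorm, one_mul, mul_one, Complex.norm_I, Complex.norm_real]
    have h1 : ‖joukowskyLift p m (Complex.exp (θ * ((1 : ℝ) * Complex.I)))‖ ≤ M := by
      simpa using norm_joukowskyLift_le hp hM le_rfl (hnorm 1 θ).le
    have h2 := norm_deriv_joukowskyLift_le hm hp hM (hnorm 1 θ)
    have h3 : ‖(-m : ℝ)‖ = m := by simp
    rw [h3, norm_one, mul_one]
    nlinarith [mul_le_mul_of_nonneg_left h1 (Nat.cast_nonneg (α := ℝ) m)]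

/-! ### The Nikolskii inequality for Jacobi weights -/

theorem min_rpow_le_rpow {a b u : ℝ} (ha : 0 < a) (hau : a ≤ u) (hub : u ≤ b) (s : ℝ) :
    min (a ^ s) (b ^ s) ≤ u ^ s := by
  rcases le_total 0 s with hs | hs
  · exact (min_le_left _ _).trans (Real.rpow_le_rpow ha.le hau hs)
  · exact (min_le_right _ _).trans (Real.rpow_le_rpow_of_nonpos (ha.trans_le hau) hub hs)

theorem rpow_le_max_rpow {a b u : ℝ} (ha : 0 < a) (hau : a ≤ u) (hub : u ≤ b) (s : ℝ) :
    u ^ s ≤ max (a ^ s) (b ^ s) := by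
  rcases le_total 0 s with hs | hs
  · exact (Real.rpow_le_rpow (ha.le.trans hau) hub hs).trans (le_max_right _ _)
  · exact (Real.rpow_le_rpow_of_nonpos ha hau hs).trans (le_max_left _ _)

/-- Away from `-1` the Jacobi measure of an interval is bounded below by its length times a lower
bound of the factor `(1 - t) ^ α`. -/
theorem exists_mul_le_jacobiMeasure_Icc {α β : ℝ} (hα : -1 < α) (hβ : -1 < β) :
    ∃ c : ℝ, 0 < c ∧ ∀ a b L : ℝ, -1 / 2 ≤ a → a ≤ b → b ≤ 1 → 0 ≤ L →
      (∀ t ∈ Set.Icc a b, L ≤ (1 - t) ^ α) →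
      c * (L * (b - a)) ≤ (jacobiMeasure α β).real (Set.Icc a b) := by
  have := isProbabilityMeasure_jacobiMeasure hα hβ
  set mβ : ℝ := min ((1 / 2 : ℝ) ^ β) (2 ^ β) with hmβ
  have hmβ0 : 0 < mβ := lt_min (by positivity) (by positivity)
  refine ⟨jacobiConst α β * mβ, mul_pos (jacobiConst_pos hα hβ) hmβ0,
    fun a b L ha hab hb hL h => ?_⟩
  rw [measureReal_def]
  refine (ENNReal.ofReal_le_iff_le_toReal (measure_ne_top _ _)).1 ?_
  rw [jacobiMeasure, withDensity_apply _ measurableSet_Icc,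
    Measure.restrict_restrict measurableSet_Icc, Set.inter_eq_left.2
      (Set.Icc_subset_Icc (by linarith) hb)]
  have hc0 := jacobiConst_pos hα hβ
  calc ENNReal.ofReal (jacobiConst α β * mβ * (L * (b - a)))
      = ∫⁻ _ in Set.Icc a b, ENNReal.ofReal (jacobiConst α β * mβ * L) := by
        rw [setLIntegral_const, Real.volume_Icc, ← ENNReal.ofReal_mul (by positivity)]
        congr 1; ring
    _ ≤ _ := by
        refine setLIntegral_mono (measurable_jacobiWeight α β).ennreal_ofReal fun t ht => ?_
        refine ENNReal.ofReal_le_ofReal ?_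
        rw [jacobiWeight, mul_assoc, mul_comm mβ]
        refine mul_le_mul_of_nonneg_left ?_ hc0.le
        refine mul_le_mul (h t ht) ?_ hmβ0.le (hL.trans (h t ht))
        exact min_rpow_le_rpow (by norm_num) (by linarith [ht.1]) (by linarith [ht.2]) β

theorem quarter_le_sin {y : ℝ} (h0 : 0 ≤ y) (h1 : y ≤ 2 * Real.pi / 3) : y / 4 ≤ Real.sin y := by
  have hpi := Real.pi_pos
  have hpi4 := Real.pi_lt_four
  have hq : (1 : ℝ) / 2 ≤ 2 / Real.pi := by
    rw [div_le_div_iff₀ two_pos hpi]; linarith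
  rcases le_total y (Real.pi / 2) with h | h
  · have h2 := Real.mul_le_sin h0 h
    nlinarith
  · have h2 := Real.mul_le_sin (x := Real.pi - y) (by linarith) (by linarith)
    rw [Real.sin_pi_sub] at h2
    nlinarith

/-- Arcs of length `δ` in the variable `θ = arccos t`, with an end point in `[0, π / 2]`, have
Jacobi measure at least of the order of `δ ^ (2 + 2 γ)`. -/
theorem exists_mul_rpow_le_jacobiMeasure_arc {α β γ : ℝ} (hα : -1 < α) (hβ : -1 < β)
    (hαγ : α ≤ γ) (hγ : -1 / 2 ≤ γ) :
    ∃ c : ℝ, 0 < c ∧ ∀ θ δ : ℝ, 0 ≤ θ → θ ≤ Real.pi / 2 → 0 < δ → δ ≤ 1 / 2 →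
      c * δ ^ (2 * (1 + γ)) ≤ (jacobiMeasure α β).real
        (Set.Icc (Real.cos (θ + δ)) (Real.cos (θ + δ / 2))) := by
  obtain ⟨c₀, hc₀, H⟩ := exists_mul_le_jacobiMeasure_Icc hα hβ
  set mα : ℝ := min ((1 / 8 : ℝ) ^ α) (2 ^ α) with hmα
  have hmα0 : 0 < mα := lt_min (by positivity) (by positivity)
  refine ⟨c₀ * (mα * (2 ^ (2 * α - 2 * γ) * (1 / 2) ^ (2 * γ + 1) / 16)), by positivity,
    fun θ δ hθ0 hθ1 hδ0 hδ1 => ?_⟩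
  have hpi3 := Real.pi_gt_three
  have hpi4 := Real.pi_lt_d2
  -- working from the midpoint `φ` of the arc keeps `φ ≥ δ / 2`, and makes `1 - t` comparable to
  -- `φ ^ 2`
  set φ := θ + δ / 2 with hφ
  have hφ0 : 0 < φ := by positivity
  have hφ2 : φ ≤ 2 := by linarith
  have hend : θ + δ ≤ 2 * Real.pi / 3 := by linarith
  have ha : -1 / 2 ≤ Real.cos (θ + δ) := by
    have h1 : Real.cos (2 * Real.pi / 3) = -1 / 2 := by
      rw [show 2 * Real.pi / 3 = Real.pi - Real.pi / 3 by ring, Real.cos_pi_sub,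
        Real.cos_pi_div_three]
      norm_num
    rw [← h1]
    exact Real.cos_le_cos_of_nonneg_of_le_pi (by linarith) (by linarith) hend
  have hlen : φ * δ / 16 ≤ Real.cos φ - Real.cos (θ + δ) := by
    rw [Real.cos_sub_cos, show (φ - (θ + δ)) / 2 = -(δ / 4) by rw [hφ]; ring, Real.sin_neg]
    have h1 := quarter_le_sin (y := (φ + (θ + δ)) / 2) (by linarith) (by linarith)
    have h2 := Real.mul_le_sin (x := δ / 4) (by linarith) (by linarith)
    have hq : (1 : ℝ) / 2 ≤ 2 / Real.pi := by
      rw [div_le_div_iff₀ two_pos Real.pi_pos]; linarith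
    have h3 : δ / 8 ≤ Real.sin (δ / 4) := by nlinarith
    have h4 : φ / 4 ≤ Real.sin ((φ + (θ + δ)) / 2) := by linarith
    nlinarith [mul_le_mul h4 h3 (by positivity) (by linarith)]
  have hpt : ∀ t ∈ Set.Icc (Real.cos (θ + δ)) (Real.cos φ), mα * φ ^ (2 * α) ≤ (1 - t) ^ α := by
    intro t ht
    have h1 : 1 / 8 * φ ^ 2 ≤ 1 - t := by
      have h2 := Real.cos_le_one_sub_mul_cos_sq (x := φ) (by
        rw [abs_of_pos hφ0]; linarith)
      have h3 : (1 : ℝ) / 8 ≤ 2 / Real.pi ^ 2 := by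
        rw [div_le_div_iff₀ (by norm_num) (by positivity)]
        nlinarith
      nlinarith [ht.2, mul_le_mul_of_nonneg_right h3 (sq_nonneg φ)]
    have h2 : 1 - t ≤ 2 * φ ^ 2 := by
      have h3 := Real.one_sub_sq_div_two_le_cos (x := θ + δ)
      have h4 : (θ + δ) ^ 2 ≤ (2 * φ) ^ 2 := pow_le_pow_left₀ (by linarith) (by linarith) 2
      nlinarith [ht.1]
    have hφ2' : (φ ^ 2) ^ α = φ ^ (2 * α) := by
      rw [Real.rpow_mul hφ0.le]; norm_num
    calc mα * φ ^ (2 * α) = min ((1 / 8 * φ ^ 2) ^ α) ((2 * φ ^ 2) ^ α) := by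
          rw [Real.mul_rpow (by norm_num) (by positivity),
            Real.mul_rpow (by norm_num) (by positivity), hφ2',
            ← min_mul_of_nonneg _ _ (by positivity)]
      _ ≤ _ := min_rpow_le_rpow (by positivity) h1 h2 α
  have hmain := H (Real.cos (θ + δ)) (Real.cos φ) (mα * φ ^ (2 * α)) ha
    (Real.cos_le_cos_of_nonneg_of_le_pi hφ0.le (by linarith) (by linarith)) (Real.cos_le_one _)
    (by positivity) hpt
  refine le_trans ?_ hmain
  rw [mul_assoc]
  refine mul_le_mul_of_nonneg_left ?_ hc₀.le
  rw [mul_assoc, mul_assoc]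
  refine mul_le_mul_of_nonneg_left ?_ hmα0.le
  have h5 : (2 : ℝ) ^ (2 * α - 2 * γ) ≤ φ ^ (2 * α - 2 * γ) :=
    Real.rpow_le_rpow_of_nonpos hφ0 hφ2 (by linarith)
  have h6 : (1 / 2 * δ) ^ (2 * γ + 1) ≤ φ ^ (2 * γ + 1) :=
    Real.rpow_le_rpow (by positivity) (by linarith) (by linarith)
  calc 2 ^ (2 * α - 2 * γ) * (1 / 2) ^ (2 * γ + 1) / 16 * δ ^ (2 * (1 + γ))
      = 2 ^ (2 * α - 2 * γ) * (1 / 2 * δ) ^ (2 * γ + 1) * (δ / 16) := by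
        rw [Real.mul_rpow (by norm_num) hδ0.le,
          show 2 * (1 + γ) = 2 * γ + 1 + 1 by ring, Real.rpow_add_one hδ0.ne']
        ring
    _ ≤ φ ^ (2 * α - 2 * γ) * φ ^ (2 * γ + 1) * (δ / 16) := by gcongr
    _ = φ ^ (2 * α) * (φ * δ / 16) := by
        rw [← Real.rpow_add hφ0, show 2 * α - 2 * γ + (2 * γ + 1) = 2 * α + 1 by ring,
          Real.rpow_add_one hφ0.ne']
        ring
    _ ≤ _ := mul_le_mul_of_nonneg_left hlen (by positivity)

/-- The Nikolskii inequality when `|p|` attains its maximum in `[0, 1]`: by Bernstein's inequality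
`|p|` stays above half its maximum on an arc of length of the order of `1 / m`. -/
theorem eval_sq_le_of_max_right {α β γ : ℝ} (hα : -1 < α) (hβ : -1 < β)
    (hαγ : α ≤ γ) (hγ : -1 / 2 ≤ γ) :
    ∃ C : ℝ, 0 < C ∧ ∀ m : ℕ, 1 ≤ m → ∀ p : ℝ[X], p.natDegree ≤ m → ∀ x ∈ Set.Icc (0 : ℝ) 1,
      (∀ t ∈ Set.Icc (-1 : ℝ) 1, |p.eval t| ≤ |p.eval x|) →
      p.eval x ^ 2 ≤ C * (m : ℝ) ^ (2 * (1 + γ)) * ∫ t, p.eval t ^ 2 ∂(jacobiMeasure α β) := by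
  have := isProbabilityMeasure_jacobiMeasure hα hβ
  obtain ⟨c, hc, H⟩ := exists_mul_rpow_le_jacobiMeasure_arc hα hβ hαγ hγ
  refine ⟨4 * (c * (1 / 18) ^ (2 * (1 + γ)))⁻¹, by positivity, fun m hm p hp x hx hmax => ?_⟩
  have hm0 : (0 : ℝ) < m := by exact_mod_cast hm
  have hm1 : (1 : ℝ) ≤ m := by exact_mod_cast hm
  set M := |p.eval x| with hM
  -- the Lipschitz constant `9 m M` of `θ ↦ p (cos θ)` allows a drop by `M / 2` over this length
  set δ : ℝ := 1 / 18 / m with hδ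
  have hδ0 : 0 < δ := by positivity
  have hδ1 : δ ≤ 1 / 2 := by
    rw [hδ, div_le_iff₀ hm0]; linarith
  have hθ1 : Real.arccos x ≤ Real.pi / 2 := Real.arccos_le_pi_div_two.2 hx.1
  have hθ0 := Real.arccos_nonneg x
  have hcos : Real.cos (Real.arccos x) = x := Real.cos_arccos (by linarith [hx.1]) hx.2
  have hmeas := H (Real.arccos x) δ hθ0 hθ1 hδ0 hδ1
  have hpi3 := Real.pi_gt_three
  have hsub : Set.Icc (Real.cos (Real.arccos x + δ)) (Real.cos (Real.arccos x + δ / 2)) ⊆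
      {t | (M / 2) ^ 2 ≤ p.eval t ^ 2} := by
    intro t ht
    have ht1 : -1 ≤ t := (Real.neg_one_le_cos _).trans ht.1
    have ht2 : t ≤ 1 := ht.2.trans (Real.cos_le_one _)
    have hlow : Real.arccos x + δ / 2 ≤ Real.arccos t := by
      have := Real.arccos_le_arccos ht.2
      rwa [Real.arccos_cos (by linarith) (by linarith)] at this
    have hupp : Real.arccos t ≤ Real.arccos x + δ := by
      have := Real.arccos_le_arccos ht.1
      rwa [Real.arccos_cos (by linarith) (by linarith)] at this
    have hb := abs_eval_cos_sub_le hm hp hmax (Real.arccos x) (Real.arccos t)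
    rw [hcos, Real.cos_arccos ht1 ht2] at hb
    have habs : |Real.arccos x - Real.arccos t| ≤ δ := by
      rw [abs_le]; constructor <;> linarith
    have h3 : 9 * m * M * |Real.arccos x - Real.arccos t| ≤ M / 2 := by
      calc 9 * m * M * |Real.arccos x - Real.arccos t| ≤ 9 * m * M * δ := by gcongr
        _ = M / 2 := by rw [hδ]; field_simp; ring
    have h4 : M / 2 ≤ |p.eval t| := by
      have := abs_sub_abs_le_abs_sub (p.eval x) (p.eval t)
      linarith
    show (M / 2) ^ 2 ≤ p.eval t ^ 2
    rw [← sq_abs (p.eval t)]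
    exact pow_le_pow_left₀ (by positivity) h4 2
  have h5 := mul_meas_ge_le_integral_of_nonneg
    (Filter.Eventually.of_forall fun t => sq_nonneg (p.eval t))
    (integrable_sq_eval_jacobiMeasure hα hβ p) ((M / 2) ^ 2)
  have h6 := hmeas.trans (measureReal_mono hsub)
  have h7 := (mul_le_mul_of_nonneg_left h6 (sq_nonneg (M / 2))).trans h5
  have h8 : δ ^ (2 * (1 + γ)) = (1 / 18) ^ (2 * (1 + γ)) / (m : ℝ) ^ (2 * (1 + γ)) :=
    Real.div_rpow (by norm_num) hm0.le _
  rw [h8] at h7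
  have hmp : 0 < (m : ℝ) ^ (2 * (1 + γ)) := by positivity
  have h18 : 0 < (1 / 18 : ℝ) ^ (2 * (1 + γ)) := by positivity
  rw [← sq_abs (p.eval x), ← hM]
  calc M ^ 2 = 4 * (c * (1 / 18) ^ (2 * (1 + γ)))⁻¹ * (m : ℝ) ^ (2 * (1 + γ)) *
        ((M / 2) ^ 2 * (c * ((1 / 18) ^ (2 * (1 + γ)) / (m : ℝ) ^ (2 * (1 + γ))))) := by
        field_simp
        norm_num
    _ ≤ _ := mul_le_mul_of_nonneg_left h7 (by positivity)

theorem integral_sq_eval_comp_neg (α β : ℝ) (p : ℝ[X]) :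
    ∫ t, (p.comp (-Polynomial.X)).eval t ^ 2 ∂(jacobiMeasure α β) =
      ∫ t, p.eval t ^ 2 ∂(jacobiMeasure β α) := by
  rw [← (measurePreserving_neg_jacobiMeasure α β).integral_comp
    (MeasurableEquiv.neg ℝ).measurableEmbedding]
  simp

/-- A Nikolskii inequality for Jacobi weights. A maximum in `[-1, 0]` is moved to `[0, 1]` by the
reflection, which exchanges `α` and `β`. -/
theorem exists_eval_sq_le_integral_sq {α β : ℝ} (hα : -1 < α) (hβ : -1 < β)
    (hγ : -1 / 2 ≤ max α β) :
    ∃ C : ℝ, 0 < C ∧ ∀ m : ℕ, 1 ≤ m → ∀ p ∈ Polynomial.degreeLE ℝ m, ∀ x ∈ Set.Icc (-1 : ℝ) 1,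
      p.eval x ^ 2 ≤ C * (m : ℝ) ^ (2 * (1 + max α β)) *
        ∫ t, p.eval t ^ 2 ∂(jacobiMeasure α β) := by
  obtain ⟨C₁, hC₁, H₁⟩ := eval_sq_le_of_max_right hα hβ (le_max_left α β) hγ
  obtain ⟨C₂, hC₂, H₂⟩ := eval_sq_le_of_max_right hβ hα (le_max_right α β) hγ
  refine ⟨C₁ + C₂, by positivity, fun m hm p hp x hx => ?_⟩
  have hdeg : p.natDegree ≤ m := Polynomial.natDegree_le_of_degree_le (Polynomial.mem_degreeLE.1 hp)
  obtain ⟨y, hy, hmax⟩ := isCompact_Icc.exists_isMaxOn (s := Set.Icc (-1 : ℝ) 1) ⟨x, hx⟩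
    (f := fun t => |p.eval t|) p.continuous.abs.continuousOn
  have hmax' : ∀ t ∈ Set.Icc (-1 : ℝ) 1, |p.eval t| ≤ |p.eval y| := fun t ht => hmax ht
  have hxy : p.eval x ^ 2 ≤ p.eval y ^ 2 := by
    rw [← sq_abs, ← sq_abs (p.eval y)]
    exact pow_le_pow_left₀ (abs_nonneg _) (hmax' x hx) 2
  have hI := integral_sq_eval_nonneg (jacobiMeasure α β) p
  have hmp : (0 : ℝ) ≤ (m : ℝ) ^ (2 * (1 + max α β)) := by positivity
  refine hxy.trans ?_
  rcases le_total 0 y with h0 | h0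
  · refine (H₁ m hm p hdeg y ⟨h0, hy.2⟩ hmax').trans ?_
    gcongr
    linarith
  · have h1 := H₂ m hm (p.comp (-Polynomial.X)) (by
      rw [Polynomial.natDegree_comp]; simpa using hdeg) (-y) ⟨by linarith, by linarith [hy.1]⟩
      (fun t ht => by
        simpa using hmax' (-t) ⟨by linarith [ht.2], by linarith [ht.1]⟩)
    rw [integral_sq_eval_comp_neg] at h1
    simp only [Polynomial.eval_comp, Polynomial.eval_neg, Polynomial.eval_X, neg_neg] at h1
    refine h1.trans ?_
    gcongr
    linarith

/-! ### Sufficiency of the sampling rate -/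

theorem l2Norm_sq (ρ : Measure ℝ) (p : ℝ[X]) : l2Norm ρ p ^ 2 = ∫ t, p.eval t ^ 2 ∂ρ := by
  simp only [l2Norm, sq_abs]
  exact Real.sq_sqrt (integral_sq_eval_nonneg ρ p)

theorem l2Norm_nonneg (ρ : Measure ℝ) (p : ℝ[X]) : 0 ≤ l2Norm ρ p := Real.sqrt_nonneg _

theorem integral_sq_sum_smul {α β : ℝ} (hα : -1 < α) (hβ : -1 < β) {d : Type*} [Fintype d]
    [DecidableEq d] {φ : d → ℝ[X]}
    (horth : ∀ i j, ∫ t, (φ i).eval t * (φ j).eval t ∂(jacobiMeasure α β) = if i = j then 1 else 0)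
    (c : d → ℝ) :
    ∫ t, (∑ i, c i • φ i).eval t ^ 2 ∂(jacobiMeasure α β) = ∑ i, c i ^ 2 := by
  have hint : ∀ p q : ℝ[X], Integrable (fun t => p.eval t * q.eval t) (jacobiMeasure α β) :=
    fun p q => by simpa using integrable_eval_jacobiMeasure hα hβ (p * q)
  have hexp : ∀ t, (∑ i, c i • φ i).eval t ^ 2 =
      ∑ i, ∑ j, c i * c j * ((φ i).eval t * (φ j).eval t) := by
    intro t
    simp only [Polynomial.eval_finsetSum, Polynomial.eval_smul, smul_eq_mul, pow_two,
      Finset.sum_mul_sum]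
    exact Finset.sum_congr rfl fun i _ => Finset.sum_congr rfl fun j _ => by ring
  simp only [hexp]
  refine (integral_finsetSum _ fun i _ => integrable_finsetSum _ fun j _ =>
    (hint (φ i) (φ j)).const_mul _).trans (Finset.sum_congr rfl fun i _ => ?_)
  refine (integral_finsetSum _ fun j _ => (hint (φ i) (φ j)).const_mul _).trans ?_
  simp [integral_const_mul, horth, pow_two]

/-- The Nikolskii inequality as a bound of the Christoffel function: apply it to
`∑ i, φ i x • φ i`. -/
theorem sum_sq_eval_le {α β : ℝ} (hα : -1 < α) (hβ : -1 < β) {m : ℕ} {C : ℝ} {d : Type*} [Fintype d]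
    [DecidableEq d] {φ : d → ℝ[X]} (hφ : ∀ i, φ i ∈ Polynomial.degreeLE ℝ m)
    (horth : ∀ i j, ∫ t, (φ i).eval t * (φ j).eval t ∂(jacobiMeasure α β) = if i = j then 1 else 0)
    {x : ℝ} (hC0 : 0 ≤ C)
    (hC : ∀ p ∈ Polynomial.degreeLE ℝ m,
      p.eval x ^ 2 ≤ C * ∫ t, p.eval t ^ 2 ∂(jacobiMeasure α β)) :
    ∑ i, (φ i).eval x ^ 2 ≤ C := by
  set s := ∑ i, (φ i).eval x ^ 2 with hs
  have h := hC (∑ i, (φ i).eval x • φ i)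
    (Submodule.sum_mem _ fun i _ => Submodule.smul_mem _ _ (hφ i))
  rw [integral_sq_sum_smul hα hβ horth, ← hs] at h
  have h2 : (∑ i, (φ i).eval x • φ i).eval x = s := by
    simp [Polynomial.eval_finsetSum, hs, pow_two]
  rw [h2] at h
  have h3 : 0 ≤ s := Finset.sum_nonneg fun i _ => sq_nonneg _
  by_contra! hlt
  nlinarith

/-- In orthonormal coordinates, the lower bound `n / 4` on the unit sphere says `‖p‖ ≤ 2
‖p‖_{n,2}` for all polynomials of degree at most `m`. -/
theorem condNumber_le_two_of_forall_sum_sq_ge {α β : ℝ} (hα : -1 < α) (hβ : -1 < β) {m n : ℕ}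
    (hn : 0 < n) {d : Type*} [Fintype d] [DecidableEq d] {φ : d → ℝ[X]}
    (horth : ∀ i j, ∫ t, (φ i).eval t * (φ j).eval t ∂(jacobiMeasure α β) = if i = j then 1 else 0)
    (hspan : ∀ p ∈ Polynomial.degreeLE ℝ m, ∃ c : d → ℝ, p = ∑ i, c i • φ i) {x : Fin n → ℝ}
    (h : ∀ v : d → ℝ, v ⬝ᵥ v = 1 →
      (n : ℝ) / 4 ≤ ∑ i, ((fun k => (φ k).eval (x i)) ⬝ᵥ v) ^ 2) :
    condNumber (jacobiMeasure α β) m x ≤ 2 := by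
  have hn0 : (0 : ℝ) < n := by exact_mod_cast hn
  rw [show (2 : ℝ≥0∞) = ENNReal.ofReal 2 by simp]
  refine condNumber_le (by norm_num) fun p hp => ?_
  refine (sq_le_sq₀ (l2Norm_nonneg _ _) (mul_nonneg two_pos.le (empNorm_nonneg _ _))).1 ?_
  obtain ⟨c, rfl⟩ := hspan p hp
  rw [mul_pow, empNorm_sq, l2Norm_sq, integral_sq_sum_smul hα hβ horth]
  set s := ∑ i, c i ^ 2 with hs
  have heval : ∀ t, (∑ i, c i • φ i).eval t = (fun k => (φ k).eval t) ⬝ᵥ c := by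
    intro t
    simp [Polynomial.eval_finsetSum, dotProduct, mul_comm]
  simp only [heval]
  have hs0 : 0 ≤ s := Finset.sum_nonneg fun i _ => sq_nonneg _
  rcases hs0.eq_or_lt with h0 | h0
  · rw [← h0]; positivity
  have hr : 0 < Real.sqrt s := Real.sqrt_pos.2 h0
  have hr2 : Real.sqrt s * Real.sqrt s = s := Real.mul_self_sqrt hs0
  have hunit := h ((Real.sqrt s)⁻¹ • c) (by
    rw [smul_dotProduct, dotProduct_smul, smul_smul, ← mul_inv, hr2, smul_eq_mul,
      show c ⬝ᵥ c = s by simp only [dotProduct, hs, pow_two], inv_mul_cancel₀ h0.ne'])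
  simp only [dotProduct_smul, smul_eq_mul, mul_pow, ← Finset.mul_sum, inv_pow,
    Real.sq_sqrt hs0] at hunit
  rw [inv_mul_eq_div, le_div_iff₀ h0] at hunit
  calc s = 2 ^ 2 * (1 / n * (n / 4 * s)) := by field_simp; norm_num
    _ ≤ _ := by gcongr

/-- Sufficiency of the sampling rate: the matrix Chernoff bound with `K` the Nikolskii bound of the
Christoffel function. -/
theorem exists_sampling_rate_sufficient {α β : ℝ} (hα : -1 < α) (hβ : -1 < β)
    (hγ : -1 / 2 ≤ max α β) {r : ℝ} (hr : 0 < r) :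
    ∃ c : ℝ, 0 < c ∧ ∀ m n : ℕ, 1 ≤ m → m < n →
      (m : ℝ) ^ (2 * (1 + max α β)) * Real.log n ≤ c * n →
      ENNReal.ofReal (1 - 2 * (n : ℝ) ^ (-r)) ≤
        sampleLaw α β n {x | condNumber (jacobiMeasure α β) m x ≤ 2} := by
  have := isProbabilityMeasure_jacobiMeasure hα hβ
  obtain ⟨C, hC, H⟩ := exists_eval_sq_le_integral_sq hα hβ hγ
  refine ⟨3 / (8 * C * (r + 1)), by positivity, fun m n hm hmn hlog => ?_⟩
  have hn : 0 < n := (Nat.zero_le m).trans_lt hmn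
  have hn0 : (0 : ℝ) < n := by exact_mod_cast hn
  have hm0 : (0 : ℝ) < m := by exact_mod_cast hm
  obtain ⟨φ, hφ, horth, hspan⟩ := exists_orthonormal_polynomials hα hβ m
  set K := C * (m : ℝ) ^ (2 * (1 + max α β)) with hK
  have hK0 : 0 < K := by positivity
  have hcher := measure_exists_sum_sq_lt_le (μ := jacobiMeasure α β)
    (φ := fun t k => (φ k).eval t) hK0 (fun i => (φ i).continuous.measurable) (by
      filter_upwards [ae_mem_Icc_jacobiMeasure α β] with t ht
      simp only [dotProduct, ← pow_two]
      exact sum_sq_eval_le hα hβ hφ horth hK0.le fun p hp => H m hm p hp t ht)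
    (fun i j => by simpa using integrable_eval_jacobiMeasure hα hβ (φ i * φ j)) horth n
  have hbad : (m + 1 : ℝ) * Real.exp (-(3 / 8) * (n / K)) ≤ (n : ℝ) ^ (-r) := by
    have h1 : (r + 1) * Real.log n ≤ 3 / 8 * (n / K) := by
      have h2 : 3 / 8 * ((n : ℝ) / K) = (r + 1) * (3 / (8 * C * (r + 1)) * n) /
          (m : ℝ) ^ (2 * (1 + max α β)) := by
        rw [hK]; field_simp
      rw [h2, le_div_iff₀ (by positivity)]
      calc (r + 1) * Real.log n * (m : ℝ) ^ (2 * (1 + max α β)) =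
            (r + 1) * ((m : ℝ) ^ (2 * (1 + max α β)) * Real.log n) := by ring
        _ ≤ _ := by gcongr
    have h3 : (m + 1 : ℝ) ≤ n := by exact_mod_cast hmn
    calc (m + 1 : ℝ) * Real.exp (-(3 / 8) * (n / K)) ≤ n * Real.exp (Real.log n * (-(r + 1))) := by
          refine mul_le_mul h3 (Real.exp_le_exp.2 ?_) (Real.exp_pos _).le hn0.le
          linarith
      _ = (n : ℝ) ^ (-r) := by
          rw [← Real.rpow_def_of_pos hn0, show -r = -(r + 1) + 1 by ring,
            Real.rpow_add_one hn0.ne', mul_comm]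
  set A := {x : Fin n → ℝ | condNumber (jacobiMeasure α β) m x ≤ 2} with hA
  have hcompl : sampleLaw α β n Aᶜ ≤ ENNReal.ofReal ((n : ℝ) ^ (-r)) := by
    refine (measure_mono fun x hx => ?_).trans (hcher.trans (ENNReal.ofReal_le_ofReal ?_))
    · by_contra hcon
      refine hx (condNumber_le_two_of_forall_sum_sq_ge hα hβ hn horth hspan fun v hv => ?_)
      by_contra! hlt
      exact hcon ⟨v, hv, hlt⟩
    · simpa using hbad
  have hprob : IsProbabilityMeasure (sampleLaw α β n) := by
    unfold sampleLaw; infer_instance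
  have htot : 1 ≤ sampleLaw α β n A + sampleLaw α β n Aᶜ := by
    rw [← measure_univ (μ := sampleLaw α β n), ← Set.union_compl_self A]
    exact measure_union_le _ _
  have hpow : 0 < (n : ℝ) ^ (-r) := Real.rpow_pos_of_pos hn0 _
  calc ENNReal.ofReal (1 - 2 * (n : ℝ) ^ (-r)) ≤ ENNReal.ofReal (1 - (n : ℝ) ^ (-r)) :=
        ENNReal.ofReal_le_ofReal (by linarith)
    _ = 1 - ENNReal.ofReal ((n : ℝ) ^ (-r)) := by
        rw [ENNReal.ofReal_sub _ hpow.le, ENNReal.ofReal_one]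
    _ ≤ 1 - sampleLaw α β n Aᶜ := tsub_le_tsub_left hcompl _
    _ ≤ _ := tsub_le_iff_right.2 htot

/-! ### Fejér-type polynomials and integrals of the Jacobi weight -/

/-- The quotient `(1 - T k) / (1 - X)`, where `T k` is the Chebyshev polynomial. -/
theorem exists_fejer_polynomial (k : ℕ) :
    ∃ q : ℝ[X], q.natDegree ≤ k - 1 ∧
      ∀ θ : ℝ, (1 - Real.cos θ) * q.eval (Real.cos θ) = 1 - Real.cos (k * θ) := by
  have hroot : (1 - Polynomial.Chebyshev.T ℝ k).IsRoot 1 := by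
    simp [Polynomial.IsRoot]
  obtain ⟨g, hg⟩ := Polynomial.dvd_iff_isRoot.2 hroot
  refine ⟨-g, ?_, fun θ => ?_⟩
  · rcases eq_or_ne g 0 with rfl | hg0
    · simp
    have h1 : (1 - Polynomial.Chebyshev.T ℝ k).natDegree = 1 + g.natDegree := by
      rw [hg, Polynomial.natDegree_mul (Polynomial.X_sub_C_ne_zero _) hg0,
        Polynomial.natDegree_X_sub_C]
    have h2 : (1 - Polynomial.Chebyshev.T ℝ k).natDegree ≤ k := by
      refine (Polynomial.natDegree_sub_le _ _).trans ?_
      simp [Polynomial.Chebyshev.natDegree_T]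
    rw [Polynomial.natDegree_neg]
    omega
  · have h1 := congrArg (Polynomial.eval (Real.cos θ)) hg
    simp only [Polynomial.eval_sub, Polynomial.eval_one, Polynomial.eval_mul, Polynomial.eval_X,
      Polynomial.eval_C, Polynomial.Chebyshev.T_real_cos] at h1
    rw [Polynomial.eval_neg]
    push_cast at h1
    linarith

/-- In the variable `θ`, the quotient is the Fejér kernel `sin (k θ / 2) ^ 2 / sin (θ / 2) ^ 2`:
it is of size `k ^ 2` for `θ ≲ 1 / k` and decays like `2 / (1 - t)`. -/
theorem exists_fejer_polynomial_bounds {k : ℕ} (hk : 1 ≤ k) :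
    ∃ q : ℝ[X], q.natDegree ≤ k - 1 ∧
      (∀ t : ℝ, -1 ≤ t → t < 1 → |q.eval t| ≤ 2 / (1 - t)) ∧
      (∀ t : ℝ, -1 ≤ t → t < 1 → 1 - t ≤ 2 / (k : ℝ) ^ 2 → (k : ℝ) ^ 2 / 4 ≤ q.eval t) := by
  obtain ⟨q, hq, hval⟩ := exists_fejer_polynomial k
  have hk0 : (0 : ℝ) < k := by exact_mod_cast hk
  have hpi := Real.pi_pos
  refine ⟨q, hq, fun t h1 h2 => ?_, fun t h1 h2 h3 => ?_⟩
  · have h := hval (Real.arccos t)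
    rw [Real.cos_arccos h1 h2.le] at h
    rw [le_div_iff₀ (by linarith), mul_comm, ← abs_of_pos (show 0 < 1 - t by linarith),
      ← abs_mul, h, abs_le]
    constructor <;> linarith [Real.cos_le_one (k * Real.arccos t),
      Real.neg_one_le_cos (k * Real.arccos t)]
  · have h := hval (Real.arccos t)
    set θ := Real.arccos t with hθ
    have hcos : Real.cos θ = t := Real.cos_arccos h1 h2.le
    rw [hcos] at h
    have hθ0 : 0 ≤ θ := Real.arccos_nonneg t
    have hθk : θ ≤ Real.pi / k := by
      by_contra! hlt
      have h4 : Real.cos θ < Real.cos (Real.pi / k) :=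
        Real.cos_lt_cos_of_nonneg_of_le_pi (by positivity) (Real.arccos_le_pi t) hlt
      have h5 := Real.cos_le_one_sub_mul_cos_sq (x := Real.pi / k) (by
        rw [abs_of_pos (by positivity)]
        exact div_le_self hpi.le (by exact_mod_cast hk))
      have h6 : 2 / Real.pi ^ 2 * (Real.pi / k) ^ 2 = 2 / (k : ℝ) ^ 2 := by field_simp
      rw [h6] at h5
      linarith
    have hkθ : k * θ ≤ Real.pi := by
      rw [le_div_iff₀ hk0] at hθk; linarith
    have h7 := Real.cos_le_one_sub_mul_cos_sq (x := k * θ) (by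
      rw [abs_of_nonneg (by positivity)]; exact hkθ)
    have h8 := Real.one_sub_sq_div_two_le_cos (x := θ)
    rw [hcos] at h8
    have hpi4 := Real.pi_le_four
    have h9 : (1 : ℝ) / 8 ≤ 2 / Real.pi ^ 2 := by
      rw [div_le_div_iff₀ (by norm_num) (by positivity)]
      nlinarith
    have h10 : (k : ℝ) ^ 2 / 4 * (1 - t) ≤ q.eval t * (1 - t) := by
      have h11 := mul_le_mul_of_nonneg_right h9 (sq_nonneg (k * θ))
      have h12 := mul_le_mul_of_nonneg_left (show 1 - t ≤ θ ^ 2 / 2 by linarith)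
        (show 0 ≤ (k : ℝ) ^ 2 / 4 by positivity)
      have h13 : (k : ℝ) ^ 2 / 4 * (θ ^ 2 / 2) = 1 / 8 * (k * θ) ^ 2 := by ring
      linarith
    exact le_of_mul_le_mul_right h10 (by linarith)

/-- On `[0, 1]` the Jacobi weight is at most a constant times `(1 - t) ^ α`. -/
theorem exists_setLIntegral_jacobiMeasure_le {α β : ℝ} (hα : -1 < α) (hβ : -1 < β) :
    ∃ C : ℝ, 0 < C ∧ ∀ A : Set ℝ, MeasurableSet A → A ⊆ Set.Icc 0 1 → ∀ g : ℝ → ℝ≥0∞,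
      Measurable g → ∫⁻ t in A, g t ∂(jacobiMeasure α β) ≤
        ENNReal.ofReal C * ∫⁻ t in A, ENNReal.ofReal ((1 - t) ^ α) * g t := by
  set Mβ : ℝ := max ((1 : ℝ) ^ β) (2 ^ β) with hMβ
  have hMβ0 : 0 < Mβ := lt_max_of_lt_left (by positivity)
  have hc0 := jacobiConst_pos hα hβ
  refine ⟨jacobiConst α β * Mβ, by positivity, fun A hA hA1 g hg => ?_⟩
  rw [jacobiMeasure, setLIntegral_withDensity_eq_setLIntegral_mul _
    (measurable_jacobiWeight α β).ennreal_ofReal hg hA, Measure.restrict_restrict hA,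
    Set.inter_eq_left.2 (hA1.trans (Set.Icc_subset_Icc (by norm_num) le_rfl)),
    ← lintegral_const_mul' _ _ ENNReal.ofReal_ne_top]
  refine setLIntegral_mono' hA fun t ht => ?_
  have ht' := hA1 ht
  rw [Pi.mul_apply, ← mul_assoc, ← ENNReal.ofReal_mul (by positivity)]
  refine mul_le_mul_left (ENNReal.ofReal_le_ofReal ?_) _
  rw [jacobiWeight, mul_assoc, mul_comm Mβ]
  refine mul_le_mul_of_nonneg_left (mul_le_mul_of_nonneg_left ?_
    (Real.rpow_nonneg (by linarith [ht'.2]) _)) hc0.le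
  exact rpow_le_max_rpow one_pos (by linarith [ht'.1]) (by linarith [ht'.2]) β

theorem lintegral_one_sub_rpow_le {b e : ℝ} (hb : 0 < b) (hb1 : b ≤ 1) (he : e < -1) :
    ∫⁻ t in Set.Icc 0 (1 - b), ENNReal.ofReal ((1 - t) ^ e) ≤
      ENNReal.ofReal (b ^ (e + 1) / (-(e + 1))) := by
  have hcont : ContinuousOn (fun t : ℝ => (1 - t) ^ e) (Set.Icc 0 (1 - b)) :=
    ContinuousOn.rpow_const (by fun_prop) fun t ht => Or.inl (by linarith [ht.2])
  rw [← ofReal_integral_eq_lintegral_ofReal (hcont.integrableOn_Icc)]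
  · refine ENNReal.ofReal_le_ofReal ?_
    rw [integral_Icc_eq_integral_Ioc, ← intervalIntegral.integral_of_le (by linarith),
      intervalIntegral.integral_comp_sub_left (fun u : ℝ => u ^ e) 1, sub_sub_cancel, sub_zero,
      integral_rpow (Or.inr ⟨he.ne, by
        rw [Set.uIcc_of_le hb1]; exact fun h => absurd h.1 (by linarith)⟩), Real.one_rpow,
      ← neg_div_neg_eq]
    refine div_le_div_of_nonneg_right (by linarith) (by linarith)
  · filter_upwards [ae_restrict_mem measurableSet_Icc] with t ht
    exact Real.rpow_nonneg (by linarith [ht.2]) _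

theorem lintegral_one_sub_rpow_eq {b e : ℝ} (hb : 0 < b) (he : -1 < e) :
    ∫⁻ t in Set.Icc (1 - b) 1, ENNReal.ofReal ((1 - t) ^ e) =
      ENNReal.ofReal (b ^ (e + 1) / (e + 1)) := by
  rw [← ofReal_integral_eq_lintegral_ofReal]
  · congr 1
    rw [integral_Icc_eq_integral_Ioc, ← intervalIntegral.integral_of_le (by linarith),
      intervalIntegral.integral_comp_sub_left (fun u : ℝ => u ^ e) 1, sub_self, sub_sub_cancel,
      integral_rpow (Or.inl he), Real.zero_rpow (by linarith), sub_zero]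
  · exact (intervalIntegrable_iff_integrableOn_Icc_of_le (by linarith)).1
      (intervalIntegrable_one_sub_rpow he _ _)
  · filter_upwards [ae_restrict_mem measurableSet_Icc] with t ht
    exact Real.rpow_nonneg (by linarith [ht.2]) _

/-! ### Necessity of the sampling rate -/

/-- The mass outside `(1 - b, 1]` of a polynomial dominated by `(2 / (1 - t)) ^ s`. -/
theorem lintegral_Iic_sq_eval_le {α β : ℝ} (hα : -1 < α) (hβ : -1 < β) {s : ℕ}
    (hs : α + 1 < 2 * s) :
    ∃ C : ℝ, 0 < C ∧ ∀ (p : ℝ[X]) (b : ℝ), 0 < b → b ≤ 1 →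
      (∀ t : ℝ, -1 ≤ t → t < 1 → p.eval t ^ 2 ≤ (2 / (1 - t)) ^ (2 * s)) →
      ∫⁻ t in Set.Iic (1 - b), ENNReal.ofReal (p.eval t ^ 2) ∂(jacobiMeasure α β) ≤
        ENNReal.ofReal (C * b ^ (-(2 * s - α - 1))) := by
  have := isProbabilityMeasure_jacobiMeasure hα hβ
  obtain ⟨C₀, hC₀, H⟩ := exists_setLIntegral_jacobiMeasure_le hα hβ
  set E : ℝ := 2 * s - α - 1 with hE
  have hE0 : 0 < E := by linarith
  refine ⟨4 ^ s + C₀ * (4 ^ s / E), by positivity, fun p b hb hb1 hp => ?_⟩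
  have hleft : ∫⁻ t in Set.Icc (-1) 0, ENNReal.ofReal (p.eval t ^ 2) ∂(jacobiMeasure α β) ≤
      ENNReal.ofReal (4 ^ s) := by
    calc _ ≤ ∫⁻ _ in Set.Icc (-1 : ℝ) 0, ENNReal.ofReal (4 ^ s) ∂(jacobiMeasure α β) := by
          refine setLIntegral_mono' measurableSet_Icc fun t ht => ENNReal.ofReal_le_ofReal ?_
          refine (hp t ht.1 (by linarith [ht.2])).trans ?_
          rw [show (4 : ℝ) ^ s = 2 ^ (2 * s) by rw [pow_mul]; norm_num]
          refine pow_le_pow_left₀ (div_nonneg two_pos.le (by linarith [ht.2])) ?_ _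
          rw [div_le_iff₀ (by linarith [ht.2])]
          linarith [ht.2]
      _ ≤ _ := by
          rw [setLIntegral_const]
          exact mul_le_of_le_one_right' prob_le_one
  have hright : ∫⁻ t in Set.Icc 0 (1 - b), ENNReal.ofReal (p.eval t ^ 2) ∂(jacobiMeasure α β) ≤
      ENNReal.ofReal (C₀ * (4 ^ s / E) * b ^ (-E)) := by
    refine (H (Set.Icc 0 (1 - b)) measurableSet_Icc (Set.Icc_subset_Icc le_rfl (by linarith)) _
      (p.continuous.measurable.pow_const 2).ennreal_ofReal).trans ?_
    calc _ ≤ ENNReal.ofReal C₀ * ∫⁻ t in Set.Icc 0 (1 - b),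
          ENNReal.ofReal (4 ^ s) * ENNReal.ofReal ((1 - t) ^ (α - 2 * s)) := by
          refine mul_le_mul_right (setLIntegral_mono' measurableSet_Icc fun t ht => ?_) _
          have ht1 : 0 < 1 - t := by linarith [ht.2]
          rw [← ENNReal.ofReal_mul (by positivity), ← ENNReal.ofReal_mul (by positivity)]
          refine ENNReal.ofReal_le_ofReal ?_
          refine (mul_le_mul_of_nonneg_left (hp t (by linarith [ht.1]) (by linarith))
            (by positivity)).trans (le_of_eq ?_)
          have h1 : (1 - t) ^ (α - 2 * s) = (1 - t) ^ α / (1 - t) ^ (2 * s) := by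
            rw [Real.rpow_sub ht1, ← Real.rpow_natCast (1 - t) (2 * s)]
            push_cast
            rfl
          rw [h1, div_pow, show (4 : ℝ) ^ s = 2 ^ (2 * s) by rw [pow_mul]; norm_num]
          ring
      _ ≤ ENNReal.ofReal C₀ * (ENNReal.ofReal (4 ^ s) *
            ENNReal.ofReal (b ^ (α - 2 * s + 1) / (-(α - 2 * s + 1)))) := by
          rw [lintegral_const_mul' _ _ ENNReal.ofReal_ne_top]
          gcongr
          exact lintegral_one_sub_rpow_le hb hb1 (by linarith)
      _ = _ := by
          rw [← ENNReal.ofReal_mul (by positivity), ← ENNReal.ofReal_mul (by positivity),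
            show α - 2 * s + 1 = -E by rw [hE]; ring, neg_neg]
          congr 1
          ring
  have hb2 : 1 ≤ b ^ (-E) := Real.one_le_rpow_of_pos_of_le_one_of_nonpos hb hb1 (by linarith)
  have hsub : (Set.Iic (1 - b) : Set ℝ) ≤ᵐ[jacobiMeasure α β]
      (Set.Icc (-1) 0 ∪ Set.Icc 0 (1 - b) : Set ℝ) := by
    filter_upwards [ae_mem_Icc_jacobiMeasure α β] with t ht htb
    rcases le_total t 0 with h | h
    · exact Or.inl ⟨ht.1, h⟩
    · exact Or.inr ⟨h, htb⟩
  calc _ ≤ ∫⁻ t in (Set.Icc (-1) 0 ∪ Set.Icc 0 (1 - b) : Set ℝ), ENNReal.ofReal (p.eval t ^ 2)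
        ∂(jacobiMeasure α β) := lintegral_mono_set' hsub
    _ ≤ ENNReal.ofReal (4 ^ s) + ENNReal.ofReal (C₀ * (4 ^ s / E) * b ^ (-E)) :=
        (lintegral_union_le _ _ _).trans (add_le_add hleft hright)
    _ = ENNReal.ofReal (4 ^ s + C₀ * (4 ^ s / E) * b ^ (-E)) :=
        (ENNReal.ofReal_add (by positivity) (by positivity)).symm
    _ ≤ _ := by
        refine ENNReal.ofReal_le_ofReal ?_
        rw [add_mul]
        have h4 : (0 : ℝ) < 4 ^ s := by positivity
        gcongr
        exact le_mul_of_one_le_right h4.le hb2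

theorem exists_jacobiMeasure_Ioi_le {α β : ℝ} (hα : -1 < α) (hβ : -1 < β) :
    ∃ C : ℝ, 0 < C ∧ ∀ b : ℝ, 0 < b → b ≤ 1 →
      jacobiMeasure α β (Set.Ioi (1 - b)) ≤ ENNReal.ofReal (C * b ^ (α + 1)) := by
  obtain ⟨C₀, hC₀, H⟩ := exists_setLIntegral_jacobiMeasure_le hα hβ
  have hα1 : 0 < α + 1 := by linarith
  refine ⟨C₀ / (α + 1), by positivity, fun b hb hb1 => ?_⟩
  have hsub : (Set.Ioi (1 - b) : Set ℝ) ≤ᵐ[jacobiMeasure α β] (Set.Icc (1 - b) 1 : Set ℝ) := by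
    filter_upwards [ae_mem_Icc_jacobiMeasure α β] with t ht htb
    exact ⟨le_of_lt htb, ht.2⟩
  have h1 := H (Set.Icc (1 - b) 1) measurableSet_Icc (Set.Icc_subset_Icc (by linarith) le_rfl)
    (fun _ => 1) measurable_const
  simp only [mul_one, setLIntegral_const, one_mul] at h1
  refine (measure_mono_ae hsub).trans (h1.trans ?_)
  rw [lintegral_one_sub_rpow_eq hb hα, ← ENNReal.ofReal_mul hC₀.le]
  refine ENNReal.ofReal_le_ofReal (le_of_eq ?_)
  ring

/-- `ρ` admits polynomials of degree at most `m` whose `L²(ρ)` mass lies, up to a fraction `ε`, in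
sets of measure of the order of `m ^ (-e)`, for every `ε > 0` and all large `m`. -/
def ConcentratesAtRate (ρ : Measure ℝ) (e : ℝ) : Prop :=
  ∀ ε : ℝ, 0 < ε → ∃ A : ℝ, 0 < A ∧ ∃ M : ℕ, ∀ m : ℕ, M ≤ m →
    ∃ p ∈ Polynomial.degreeLE ℝ m, ∃ S : Set ℝ, MeasurableSet S ∧
      ρ S ≤ ENNReal.ofReal (A * (m : ℝ) ^ (-e)) ∧ 0 < ∫ t, p.eval t ^ 2 ∂ρ ∧
      ∫⁻ t in Sᶜ, ENNReal.ofReal (p.eval t ^ 2) ∂ρ ≤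
        ENNReal.ofReal (ε * ∫ t, p.eval t ^ 2 ∂ρ)

/-- Powers of the polynomials `(1 - T k) / (1 - X)` concentrate in intervals `(1 - B / k ^ 2, 1]`.
-/
theorem concentratesAtRate_right {α β : ℝ} (hα : -1 < α) (hβ : -1 < β) :
    ConcentratesAtRate (jacobiMeasure α β) (2 * (1 + α)) := by
  intro ε hε
  have := isProbabilityMeasure_jacobiMeasure hα hβ
  have hα1 : 0 < α + 1 := by linarith
  -- any power `s` with `2 s > α + 1` makes `(1 - t) ^ (α - 2 s)` non-integrable at `1`, so that the
  -- mass sits near `1`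
  set s : ℕ := ⌈α + 1⌉₊ with hs
  have hsα : α + 1 ≤ s := Nat.le_ceil _
  have hs0 : 0 < s := Nat.ceil_pos.2 hα1
  have hs0' : (0 : ℝ) < s := by exact_mod_cast hs0
  set E : ℝ := 2 * s - α - 1 with hE
  have hE0 : 0 < E := by linarith
  obtain ⟨C₁, hC₁, H₁⟩ := lintegral_Iic_sq_eval_le (s := s) hα hβ (by linarith)
  obtain ⟨C₂, hC₂, H₂⟩ := exists_jacobiMeasure_Ioi_le hα hβ
  obtain ⟨c₀, hc₀, H₃⟩ := exists_mul_le_jacobiMeasure_Icc hα hβ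
  set mα : ℝ := min ((1 : ℝ) ^ α) (2 ^ α) with hmα
  have hmα0 : 0 < mα := lt_min (by positivity) (by positivity)
  set c₁ : ℝ := (1 / 4) ^ (2 * s) * (c₀ * mα) with hc₁
  have hc₁0 : 0 < c₁ := by positivity
  -- the constant `B` makes the mass outside the cap at most a fraction `ε` of the total mass
  obtain ⟨B, hB1, hB⟩ : ∃ B : ℝ, 1 ≤ B ∧ C₁ * B ^ (-E) ≤ ε * c₁ := by
    have h1 := (tendsto_rpow_neg_atTop hE0).const_mul C₁
    rw [mul_zero] at h1
    obtain ⟨B, hB⟩ := ((h1.eventually_le_const (by positivity : 0 < ε * c₁)).and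
      (Filter.eventually_ge_atTop 1)).exists
    exact ⟨B, hB.2, hB.1⟩
  have hB0 : 0 < B := by linarith
  refine ⟨C₂ * B ^ (α + 1) * (s : ℝ) ^ (2 * (1 + α)), by positivity, s * ⌈B + 2⌉₊, fun m hm => ?_⟩
  -- `q ^ s` has degree at most `s * (k - 1) ≤ m`, while `k ≥ m / s`
  set k : ℕ := m / s + 1 with hk
  have hkm : (m : ℝ) / s ≤ k := by
    rw [div_le_iff₀ hs0']
    have h1 := Nat.lt_div_mul_add (a := m) hs0
    have h2 : m ≤ k * s := by rw [hk, add_mul, one_mul]; exact h1.le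
    exact_mod_cast h2
  have hkB : B + 2 ≤ k := by
    refine le_trans ?_ hkm
    rw [le_div_iff₀ hs0']
    calc (B + 2) * s ≤ (⌈B + 2⌉₊ : ℝ) * s := by gcongr; exact Nat.le_ceil _
      _ ≤ m := by rw [mul_comm]; exact_mod_cast hm
  have hm0 : (0 : ℝ) < m := by
    have h1 : 0 < s * ⌈B + 2⌉₊ := Nat.mul_pos hs0 (Nat.ceil_pos.2 (by linarith))
    exact_mod_cast h1.trans_le hm
  have hk0 : (0 : ℝ) < k := by linarith
  have hk2 : B ≤ (k : ℝ) ^ 2 := by nlinarith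
  set h : ℝ := 1 / (k : ℝ) ^ 2 with hh
  have hh0 : 0 < h := by positivity
  have hh1 : h ≤ 1 / 4 := by
    rw [hh]
    exact one_div_le_one_div_of_le (by norm_num) (by nlinarith)
  have hBh : B * h ≤ 1 := by
    rw [hh, mul_one_div]
    exact (div_le_one (by positivity)).2 hk2
  obtain ⟨q, hqdeg, hqup, hqlow⟩ := exists_fejer_polynomial_bounds (k := k) (Nat.le_add_left 1 _)
  -- lower bound of the total mass, from the interval `[1 - 2 h, 1 - h]` where `q ≥ k ^ 2 / 4`
  have hlow : c₁ * h ^ (-E) ≤ ∫ t, (q ^ s).eval t ^ 2 ∂(jacobiMeasure α β) := by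
    have h1 := H₃ (1 - 2 * h) (1 - h) (mα * h ^ α) (by linarith) (by linarith) (by linarith)
      (by positivity) (fun t ht => by
        calc mα * h ^ α = min ((1 * h) ^ α) ((2 * h) ^ α) := by
              rw [Real.mul_rpow (by norm_num) hh0.le, Real.mul_rpow (by norm_num) hh0.le,
                ← min_mul_of_nonneg _ _ (by positivity)]
          _ ≤ _ := min_rpow_le_rpow (by positivity) (by linarith [ht.2]) (by linarith [ht.1]) α)
    have hsub : Set.Icc (1 - 2 * h) (1 - h) ⊆
        {t | ((k : ℝ) ^ 2 / 4) ^ (2 * s) ≤ (q ^ s).eval t ^ 2} := by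
      intro t ht
      show ((k : ℝ) ^ 2 / 4) ^ (2 * s) ≤ (q ^ s).eval t ^ 2
      rw [Polynomial.eval_pow, ← pow_mul, mul_comm s 2]
      refine pow_le_pow_left₀ (by positivity) (hqlow t (by linarith [ht.1]) (by linarith [ht.2])
        ?_) _
      rw [show 2 / (k : ℝ) ^ 2 = 2 * h by rw [hh]; ring]
      linarith [ht.1]
    have h2 := mul_meas_ge_le_integral_of_nonneg
      (Filter.Eventually.of_forall fun t => sq_nonneg ((q ^ s).eval t))
      (integrable_sq_eval_jacobiMeasure hα hβ (q ^ s)) (((k : ℝ) ^ 2 / 4) ^ (2 * s))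
    refine le_trans (le_of_eq ?_) ((mul_le_mul_of_nonneg_left
      (h1.trans (measureReal_mono hsub)) (by positivity)).trans h2)
    have h3 : ((k : ℝ) ^ 2 / 4) ^ (2 * s) = (1 / 4) ^ (2 * s) * h ^ (-(2 * s : ℝ)) := by
      rw [Real.rpow_neg hh0.le, show (2 * s : ℝ) = ((2 * s : ℕ) : ℝ) by push_cast; rfl,
        Real.rpow_natCast, ← inv_pow, ← mul_pow]
      congr 1
      rw [hh, one_div, one_div, inv_inv]
      ring
    have h4 : h ^ (-E) = h ^ (-(2 * s : ℝ)) * (h ^ α * h) := by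
      rw [← Real.rpow_add_one hh0.ne', ← Real.rpow_add hh0]
      congr 1
      rw [hE]; ring
    rw [h3, h4, hc₁]
    ring
  refine ⟨q ^ s, ?_, Set.Ioi (1 - B * h), measurableSet_Ioi, ?_, ?_, ?_⟩
  · rw [Polynomial.mem_degreeLE]
    refine Polynomial.degree_le_of_natDegree_le (Polynomial.natDegree_pow_le.trans ?_)
    calc s * q.natDegree ≤ s * (m / s) := Nat.mul_le_mul_left _ (by simpa [hk] using hqdeg)
      _ ≤ m := Nat.mul_div_le m s
  · refine (H₂ (B * h) (by positivity) hBh).trans (ENNReal.ofReal_le_ofReal ?_)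
    have h1 : h ≤ (m / s : ℝ) ^ (-2 : ℝ) := by
      rw [Real.rpow_neg (by positivity), hh, one_div]
      rw [Real.rpow_two]
      exact inv_anti₀ (by positivity) (pow_le_pow_left₀ (by positivity) hkm 2)
    have h2 : h ^ (α + 1) ≤ (s : ℝ) ^ (2 * (1 + α)) * (m : ℝ) ^ (-(2 * (1 + α))) := by
      calc h ^ (α + 1) ≤ ((m / s : ℝ) ^ (-2 : ℝ)) ^ (α + 1) :=
            Real.rpow_le_rpow hh0.le h1 hα1.le
        _ = (m / s : ℝ) ^ (-(2 * (1 + α))) := by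
            rw [← Real.rpow_mul (by positivity)]
            congr 1; ring
        _ = _ := by
            rw [Real.div_rpow hm0.le hs0'.le, Real.rpow_neg hs0'.le, div_inv_eq_mul, mul_comm]
    rw [Real.mul_rpow hB0.le hh0.le]
    calc C₂ * (B ^ (α + 1) * h ^ (α + 1)) ≤ C₂ * (B ^ (α + 1) *
          ((s : ℝ) ^ (2 * (1 + α)) * (m : ℝ) ^ (-(2 * (1 + α))))) := by gcongr
      _ = _ := by ring
  · exact lt_of_lt_of_le (by positivity) hlow
  · rw [Set.compl_Ioi]
    refine (H₁ (q ^ s) (B * h) (by positivity) hBh fun t h1 h2 => ?_).trans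
      (ENNReal.ofReal_le_ofReal ?_)
    · rw [Polynomial.eval_pow, ← pow_mul, mul_comm s 2, ← Even.pow_abs (even_two_mul s)]
      exact pow_le_pow_left₀ (abs_nonneg _) (hqup t h1 h2) _
    · rw [← hE, Real.mul_rpow hB0.le hh0.le]
      calc C₁ * (B ^ (-E) * h ^ (-E)) = C₁ * B ^ (-E) * h ^ (-E) := by ring
        _ ≤ ε * c₁ * h ^ (-E) := by gcongr
        _ = ε * (c₁ * h ^ (-E)) := by ring
        _ ≤ _ := by gcongr

theorem concentratesAtRate_left {α β : ℝ} (hα : -1 < α) (hβ : -1 < β) :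
    ConcentratesAtRate (jacobiMeasure α β) (2 * (1 + β)) := by
  intro ε hε
  obtain ⟨A, hA, M, H⟩ := concentratesAtRate_right hβ hα ε hε
  refine ⟨A, hA, M, fun m hm => ?_⟩
  obtain ⟨p, hp, S, hS, h1, h2, h3⟩ := H m hm
  have hmp := measurePreserving_neg_jacobiMeasure α β
  refine ⟨p.comp (-Polynomial.X), ?_, (fun t => -t) ⁻¹' S, measurable_neg hS, ?_, ?_, ?_⟩
  · rw [Polynomial.mem_degreeLE] at hp ⊢
    refine Polynomial.degree_le_of_natDegree_le ?_
    rw [Polynomial.natDegree_comp]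
    simpa using Polynomial.natDegree_le_of_degree_le hp
  · rwa [hmp.measure_preimage hS.nullMeasurableSet]
  · rwa [integral_sq_eval_comp_neg]
  · rw [integral_sq_eval_comp_neg]
    refine le_trans (le_of_eq ?_) h3
    rw [← hmp.setLIntegral_comp_preimage hS.compl
      (p.continuous.measurable.pow_const 2).ennreal_ofReal]
    simp

theorem concentratesAtRate_max {α β : ℝ} (hα : -1 < α) (hβ : -1 < β) :
    ConcentratesAtRate (jacobiMeasure α β) (2 * (1 + max α β)) := by
  rcases max_choice α β with h | h <;> rw [h]
  · exact concentratesAtRate_right hα hβ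
  · exact concentratesAtRate_left hα hβ

/-- Independent samples from a law without atoms are almost surely distinct. -/
theorem ae_injective_pi {ρ : Measure ℝ} [IsProbabilityMeasure ρ] [NullSingletonClass ρ] (n : ℕ) :
    ∀ᵐ x ∂(Measure.pi fun _ : Fin n => ρ), Function.Injective x := by
  have hpair : ∀ i j : Fin n, i ≠ j → ∀ᵐ x ∂(Measure.pi fun _ : Fin n => ρ), x i ≠ x j := by
    intro i j hij
    cases n with
    | zero => exact i.elim0
    | succ n =>
      have hmp := measurePreserving_piFinSuccAbove (fun _ : Fin (n + 1) => ρ) i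
      obtain ⟨l, hl⟩ := Fin.exists_succAbove_eq hij.symm
      have h1 : ∀ᵐ z ∂(ρ.prod (Measure.pi fun _ : Fin n => ρ)), z.1 ≠ z.2 l := by
        have hms : MeasurableSet {z : ℝ × (Fin n → ℝ) | z.1 = z.2 l} :=
          measurableSet_eq_fun measurable_fst ((measurable_pi_apply l).comp measurable_snd)
        rw [ae_iff]
        simp only [not_not]
        rw [Measure.prod_apply_symm hms]
        simp only [Set.preimage_ofPred_eq, Set.ofPred_eq_eq_singleton, measure_singleton,
          lintegral_zero]
      have h2 := hmp.quasiMeasurePreserving.ae h1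
      filter_upwards [h2] with x hx
      rw [← hl]
      exact hx
  have hall : ∀ᵐ x ∂(Measure.pi fun _ : Fin n => ρ), ∀ i j : Fin n, i ≠ j → x i ≠ x j := by
    simp only [ae_all_iff]
    exact hpair
  filter_upwards [hall] with x hx i j hij
  by_contra hne
  exact hx i j hne hij

/-- If few sampling points are expected in a set carrying most of the mass of some polynomial, the
condition number is large: with large probability that polynomial has small empirical norm. -/
theorem measure_condNumber_le_le {ρ : Measure ℝ} [IsProbabilityMeasure ρ] [NullSingletonClass ρ]
    {m n : ℕ} (hmn : m < n) {K : ℝ} (hK : 0 < K) {p : ℝ[X]} (hp : p ∈ Polynomial.degreeLE ℝ m)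
    {S : Set ℝ} (hS : MeasurableSet S) (hpos : 0 < ∫ t, p.eval t ^ 2 ∂ρ) {ε : ℝ}
    (hSc : ∫⁻ t in Sᶜ, ENNReal.ofReal (p.eval t ^ 2) ∂ρ ≤
      ENNReal.ofReal (ε * ∫ t, p.eval t ^ 2 ∂ρ)) :
    (Measure.pi fun _ : Fin n => ρ) {x | condNumber ρ m x ≤ ENNReal.ofReal K} ≤
      n * ρ S + ENNReal.ofReal (ε * K ^ 2) := by
  have hn0 : (0 : ℝ) < n := by exact_mod_cast (Nat.zero_le m).trans_lt hmn
  set I := ∫ t, p.eval t ^ 2 ∂ρ with hI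
  set g : ℝ → ℝ≥0∞ := Sᶜ.indicator fun t => ENNReal.ofReal (p.eval t ^ 2) with hg
  have hgm : Measurable g :=
    (p.continuous.measurable.pow_const 2).ennreal_ofReal.indicator hS.compl
  have hgm' : ∀ i : Fin n, Measurable fun x : Fin n → ℝ => g (x i) := fun i =>
    hgm.comp (measurable_pi_apply i)
  set P := Measure.pi fun _ : Fin n => ρ with hP
  set T : Set (Fin n → ℝ) := {x | ENNReal.ofReal (n * I / K ^ 2) ≤ ∑ i, g (x i)} with hT
  have hmp : ∀ i, MeasurePreserving (fun x : Fin n → ℝ => x i) P ρ := fun i =>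
    measurePreserving_eval _ i
  have hcap : P (⋃ i : Fin n, (fun x : Fin n → ℝ => x i) ⁻¹' S) ≤ n * ρ S := by
    refine (measure_iUnion_fintype_le _ _).trans (le_of_eq ?_)
    simp only [(hmp _).measure_preimage hS.nullMeasurableSet, Finset.sum_const, Finset.card_univ,
      Fintype.card_fin, nsmul_eq_mul]
  have hmarkov : P T ≤ ENNReal.ofReal (ε * K ^ 2) := by
    refine (meas_ge_le_lintegral_div (Finset.measurable_sum _ fun i _ => hgm' i).aemeasurable
      (ENNReal.ofReal_pos.2 (by positivity)).ne' ENNReal.ofReal_ne_top).trans ?_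
    rw [lintegral_finsetSum _ fun i _ => hgm' i]
    have h1 : ∀ i : Fin n, ∫⁻ x, g (x i) ∂P ≤ ENNReal.ofReal (ε * I) := by
      intro i
      rw [(hmp i).lintegral_comp hgm, hg, lintegral_indicator hS.compl]
      exact hSc
    refine (ENNReal.div_le_div_right (Finset.sum_le_sum fun i _ => h1 i) _).trans ?_
    rw [Finset.sum_const, Finset.card_univ, Fintype.card_fin, nsmul_eq_mul,
      ← ENNReal.ofReal_natCast, ← ENNReal.ofReal_mul hn0.le,
      ← ENNReal.ofReal_div_of_pos (by positivity)]
    refine ENNReal.ofReal_le_ofReal (le_of_eq ?_)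
    field_simp
  have hsub : ({x | condNumber ρ m x ≤ ENNReal.ofReal K} : Set (Fin n → ℝ)) ≤ᵐ[P]
      ((⋃ i : Fin n, (fun x : Fin n → ℝ => x i) ⁻¹' S) ∪ T : Set (Fin n → ℝ)) := by
    filter_upwards [ae_injective_pi (ρ := ρ) n] with x hx hcond
    by_cases hxS : ∃ i, x i ∈ S
    · exact Or.inl (Set.mem_iUnion.2 hxS)
    · refine Or.inr ?_
      push Not at hxS
      have h1 := l2Norm_le_of_condNumber_le hmn hx hK.le hcond hp
      have h2 := pow_le_pow_left₀ (l2Norm_nonneg ρ p) h1 2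
      rw [l2Norm_sq, mul_pow, empNorm_sq, ← hI] at h2
      have h3 : ∑ i, g (x i) = ENNReal.ofReal (∑ i, p.eval (x i) ^ 2) := by
        rw [ENNReal.ofReal_sum_of_nonneg fun i _ => sq_nonneg _]
        exact Finset.sum_congr rfl fun i _ => Set.indicator_of_mem (hxS i) _
      show ENNReal.ofReal (n * I / K ^ 2) ≤ ∑ i, g (x i)
      rw [h3]
      refine ENNReal.ofReal_le_ofReal ?_
      rw [div_le_iff₀ (by positivity)]
      calc n * I ≤ n * (K ^ 2 * (1 / n * ∑ i, p.eval (x i) ^ 2)) := by gcongr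
        _ = _ := by field_simp
  exact (measure_mono_ae hsub).trans ((measure_union_le _ _).trans (add_le_add hcap hmarkov))

/-- Necessity of the sampling rate: `measure_condNumber_le_le` with `ε` so small that the Markov
term contributes at most `δ / 2`. -/
theorem exists_sampling_rate_necessary {α β : ℝ} (hα : -1 < α) (hβ : -1 < β) {K δ : ℝ}
    (hK : 0 < K) (hδ : 0 < δ) :
    ∃ c : ℝ, 0 < c ∧ ∀ m n : ℕ, 1 ≤ m → m < n →
      ENNReal.ofReal δ ≤
        sampleLaw α β n {x | condNumber (jacobiMeasure α β) m x ≤ ENNReal.ofReal K} →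
      c * (m : ℝ) ^ (2 * (1 + max α β)) ≤ n := by
  have := isProbabilityMeasure_jacobiMeasure hα hβ
  have := nullSingletonClass_jacobiMeasure α β
  have hmax : -1 < max α β := lt_max_of_lt_left hα
  obtain ⟨A, hA, M, H⟩ := concentratesAtRate_max hα hβ (δ / (2 * K ^ 2)) (by positivity)
  set e : ℝ := 2 * (1 + max α β) with he
  have he0 : 0 < e := by rw [he]; linarith
  refine ⟨min (δ / (2 * A)) (((M : ℝ) + 1) ^ (-e)), lt_min (by positivity) (by positivity),
    fun m n hm hmn hprob => ?_⟩
  have hm0 : (0 : ℝ) < m := by exact_mod_cast hm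
  have hme : 0 < (m : ℝ) ^ e := by positivity
  rcases le_total M m with hMm | hMm
  · obtain ⟨p, hp, S, hS, h1, h2, h3⟩ := H m hMm
    have h4 := hprob.trans (measure_condNumber_le_le hmn hK hp hS h2 h3)
    have h5 : δ ≤ n * (A * (m : ℝ) ^ (-e)) + δ / (2 * K ^ 2) * K ^ 2 := by
      refine (ENNReal.ofReal_le_ofReal_iff (by positivity)).1 (h4.trans ?_)
      rw [ENNReal.ofReal_add (by positivity) (by positivity),
        ENNReal.ofReal_mul (p := (n : ℝ)) (by positivity), ENNReal.ofReal_natCast]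
      gcongr
    have h6 : δ / (2 * K ^ 2) * K ^ 2 = δ / 2 := by field_simp
    rw [h6, Real.rpow_neg hm0.le] at h5
    calc min (δ / (2 * A)) (((M : ℝ) + 1) ^ (-e)) * (m : ℝ) ^ e ≤ δ / (2 * A) * (m : ℝ) ^ e := by
          gcongr
          exact min_le_left _ _
      _ = δ / 2 * ((m : ℝ) ^ e / A) := by field_simp
      _ ≤ n * (A * ((m : ℝ) ^ e)⁻¹) * ((m : ℝ) ^ e / A) := by
          gcongr
          linarith
      _ = n := by field_simp
  -- for the finitely many degrees below the threshold `M`, the trivial bound `1 ≤ n` suffices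
  · have hn1 : (1 : ℝ) ≤ n := by exact_mod_cast (Nat.zero_le m).trans_lt hmn
    refine le_trans ?_ hn1
    have hM1 : (0 : ℝ) < (M : ℝ) + 1 := by positivity
    calc min (δ / (2 * A)) (((M : ℝ) + 1) ^ (-e)) * (m : ℝ) ^ e
        ≤ ((M : ℝ) + 1) ^ (-e) * ((M : ℝ) + 1) ^ e := by
          gcongr
          · exact min_le_right _ _
          · have : (m : ℝ) ≤ M := by exact_mod_cast hMm
            linarith
      _ = 1 := by rw [← Real.rpow_add hM1, neg_add_cancel, Real.rpow_zero]

end JacobiLS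

end

theorem corollary1p5 (α β : ℝ) (hα : -1 < α) (hβ : -1 < β) (hγ : (-1 / 2 : ℝ) < max α β) :
    -- sufficiency, up to a factor of `log n`
    (∀ r : ℝ, 0 < r → ∃ c : ℝ, 0 < c ∧ ∀ m n : ℕ, 1 ≤ m → m < n →
      (m : ℝ) ^ (2 * (1 + max α β)) * Real.log n ≤ c * n →
      ENNReal.ofReal (1 - 2 * (n : ℝ) ^ (-r)) ≤
        JacobiLS.sampleLaw α β n
          {x | JacobiLS.condNumber (JacobiLS.jacobiMeasure α β) m x ≤ 2}) ∧
    -- necessity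
    (∀ K : ℝ, 0 < K → ∀ δ : ℝ, 0 < δ → ∃ c : ℝ, 0 < c ∧ ∀ m n : ℕ, 1 ≤ m → m < n →
      ENNReal.ofReal δ ≤
        JacobiLS.sampleLaw α β n
          {x | JacobiLS.condNumber (JacobiLS.jacobiMeasure α β) m x ≤ ENNReal.ofReal K} →
      c * (m : ℝ) ^ (2 * (1 + max α β)) ≤ n) :=
  ⟨fun _ hr => JacobiLS.exists_sampling_rate_sufficient hα hβ hγ.le hr,
    fun _ hK _ hδ => JacobiLS.exists_sampling_rate_necessary hα hβ hK hδ⟩
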